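/- Let $R$ be an associative ring and let $M$ be an $R$-bimodule which is $N$-nilpotent for some integer $N\ge 0$, i.e. $M^{\otimes_R (N+1)}=0$, where $M^{\otimes_R 0}=R$ and $M^{\otimes_R(i+1)}=M\otimes_R M^{\otimes_R i}$. Let $T_R(M)=\bigoplus_{i=0}^N M^{\otimes_R i}$ be the tensor ring. Modules are left modules. A $T_R(M)$-module is regarded as a pair $(A,u)$ consisting of an $R$-module $A$ and an $R$-linear map $u:M\otimes_R A\to A$; a morphism $(A,u)\to(A',u')$ is an $R$-linear map $f:A\to A'$ with $f\circ u=u'\circ(M\otimes f)$, and $U(A,u)=A$ is the forgetful functor, on which exactness is tested. For an $R$-module $X$ put $\mathrm{Ind}(X)=\bigl(\bigoplus_{i=0}^N M^{\otimes_R i}\otimes_R X,\;c_X\bigr)$, where $c_X$ is the inclusion of $M\otimes_R\bigoplus_{i=0}^N (M^{\otimes_R i}\otimes_R X)\cong\bigoplus_{i=1}^N (M^{\otimes_R i}\otimes_R X)$. For a class $\mathcal W$ of modules over a ring $S$, a $\mathcal W$-complete projective resolution is an exact complex $P^\bullet=\cdots\to P^{-1}\to P^0\to P^1\to\cdots$ of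 projective $S$-modules such that $\mathrm{Hom}_S(P^\bullet,W)$ is exact for every $W\in\mathcal W$. An $S$-module $G$ is $\mathcal W$-Gorenstein projective if $G\cong\mathrm{Im}(P^{-1}\to P^0)$ for some such $P^\bullet$; the class of these modules is denoted $\mathcal W\text{-}\mathsf{GP}(S)$. Let $\mathcal X$ be a class of $R$-modules containing all projective $R$-modules, and let $\mathrm{Ind}(\mathcal X)=\{\mathrm{Ind}(X)\mid X\in\mathcal X\}$. Suppose that (a) $M$ is compatible with respect to $\mathcal X$: for every $\mathrm{Ind}(\mathcal X)$-complete projective resolution $Q^\bullet$ of $T_R(M)$-modules, the complex $M\otimes_R U(Q^\bullet)$ is exact, and the complex $\mathrm{Hom}_{T_R(M)}(Q^\bullet,\mathrm{Ind}(M\otimes_R X))$ is exact for each $X\in\mathcal X$; (b) $M$ is admissible with respect to $\mathcal X$: $\mathrm{Ext}^1_R(G,M^{\otimes_R i}\otimes_R X)=0=\mathrm{Tor}_1^R(M,M^{\otimes_R i}\otimes_R G)$ for all $G\in\mathcal X\text{-}\mathsf{GP}(R)$, $X\in\mathcal X$ and $i\ge 0$. Then $$\mathrm{Ind}(\mathcal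 X)\text{-}\mathsf{GP}(T_R(M))=\{(A,u)\mid u \text{ is injective and } \mathrm{coker}(u)\in\mathcal X\text{-}\mathsf{GP}(R)\}.$$ -/

import Mathlib

open CategoryTheory TensorProduct

universe u

namespace TensorRing

noncomputable section

section Tensor

/-! ### The tensor product `M ⊗_R X` of an `R`-bimodule and a left `R`-module

`R` is an arbitrary (possibly noncommutative) ring. An `R`-bimodule is an abelian group `M` with a
left action (`Module R M`) and a right action (`Module Rᵐᵒᵖ M`, so that `m · r` is written
`MulOpposite.op r • m`) which commute (`SMulCommClass R Rᵐᵒᵖ M`). -/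

variable (R : Type u) [Ring R] (M : Type u) [AddCommGroup M] [Module R M] [Module Rᵐᵒᵖ M]
variable (X Y : Type u) [AddCommGroup X] [Module R X] [AddCommGroup Y] [Module R Y]

/-- The `R`-submodule of `M ⊗_ℤ X` (with `R` acting on the left of `M`) generated by the elements
`(m · r) ⊗ x - m ⊗ (r x)`. When `M` is a bimodule this set of generators is closed under the left
action of `R`, so the submodule is the subgroup generated by these elements. -/
def balancing : Submodule R (M ⊗[ℤ] X) :=
  Submodule.span R {t | ∃ (m : M) (r : R) (x : X),
    t = (MulOpposite.op r • m) ⊗ₜ[ℤ] x - m ⊗ₜ[ℤ] (r • x)}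

/-- `M ⊗_R X`, as a left `R`-module. -/
abbrev BTensor : Type u := (M ⊗[ℤ] X) ⧸ balancing R M X

variable {X Y}

/-- The `R`-linear map `M ⊗ f : M ⊗_R X → M ⊗_R Y`, `m ⊗ x ↦ m ⊗ f x`. -/
def BTensor.map (f : X →ₗ[R] Y) : BTensor R M X →ₗ[R] BTensor R M Y :=
  Submodule.mapQ (balancing R M X) (balancing R M Y)
    (TensorProduct.AlgebraTensorModule.map (LinearMap.id : M →ₗ[R] M)
      f.toAddMonoidHom.toIntLinearMap) <| by
    refine Submodule.span_le.2 ?_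
    rintro _ ⟨m, r, x, rfl⟩
    refine Submodule.subset_span ⟨m, r, f x, ?_⟩
    simp

lemma BTensor.map_mk_tmul (f : X →ₗ[R] Y) (m : M) (x : X) :
    BTensor.map R M f (Submodule.Quotient.mk (m ⊗ₜ[ℤ] x)) =
      Submodule.Quotient.mk (m ⊗ₜ[ℤ] f x) := rfl

lemma BTensor.hom_ext {Z : Type u} [AddCommGroup Z] [Module R Z] {f g : BTensor R M X →ₗ[R] Z}
    (h : ∀ (m : M) (x : X), f (Submodule.Quotient.mk (m ⊗ₜ[ℤ] x)) =
      g (Submodule.Quotient.mk (m ⊗ₜ[ℤ] x))) : f = g := by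
  refine Submodule.linearMap_qext _ (LinearMap.ext fun t => ?_)
  induction t using TensorProduct.induction_on with
  | zero => simp
  | tmul m x => exact h m x
  | add a b ha hb => rw [map_add, map_add, ha, hb]

end Tensor

section Functors

variable (R : Type u) [Ring R] (M : Type u) [AddCommGroup M] [Module R M] [Module Rᵐᵒᵖ M]

/-- The functor `M ⊗_R - : Mod(R) ⥤ Mod(R)`. -/
@[simps]
def tensorFunctor : ModuleCat.{u} R ⥤ ModuleCat.{u} R where
  obj X := ModuleCat.of R (BTensor R M X)
  map f := ModuleCat.ofHom (BTensor.map R M f.hom)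
  map_id X := by
    ext : 1
    exact BTensor.hom_ext R M fun m x => rfl
  map_comp f g := by
    ext : 1
    exact BTensor.hom_ext R M fun m x => rfl

instance : (tensorFunctor R M).Additive where
  map_add {X Y f g} := by
    ext : 1
    refine BTensor.hom_ext R M fun m x => ?_
    change Submodule.Quotient.mk (m ⊗ₜ[ℤ] (f.hom x + g.hom x)) = _
    rw [TensorProduct.tmul_add]
    rfl

/-- `M^{⊗ i} ⊗_R X`, formed as `M ⊗_R (M ⊗_R (⋯ (M ⊗_R X)))` with `i` factors `M`. -/
def tensorPow (X : ModuleCat.{u} R) : ℕ → ModuleCat.{u} R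
  | 0 => X
  | i + 1 => (tensorFunctor R M).obj (tensorPow X i)

/-- `M` is `N`-nilpotent: `M^{⊗ (N + 1)} = 0`, where `M^{⊗ 0} = R` and
`M^{⊗ (i + 1)} = M ⊗_R M^{⊗ i}`. -/
def IsNilpotentBimodule (N : ℕ) : Prop :=
  Subsingleton (tensorPow R M (ModuleCat.of R R) (N + 1))

/-- The category of modules over the tensor ring `T_R(M)`: pairs `(X, u)` of a left `R`-module `X`
(the field `a`) and an `R`-linear map `u : M ⊗_R X → X` (the field `str`); a morphism
`(X, u) → (X', u')` is an `R`-linear map `f` with `f ∘ u = u' ∘ (M ⊗ f)`. -/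
abbrev TMod : Type (u + 1) := Endofunctor.Algebra (tensorFunctor R M)

/-- The forgetful functor `U : Mod(T_R(M)) ⥤ Mod(R)`, `(X, u) ↦ X`. -/
abbrev forgetT : TMod R M ⥤ ModuleCat.{u} R := Endofunctor.Algebra.forget (tensorFunctor R M)

/-- The structure map of `Ind(X)`: followed by the projection to the summand `M^{⊗ (i + 1)} ⊗_R X`
it is `M ⊗ (projection to the summand M^{⊗ i} ⊗_R X)`, and followed by the projection to the
summand `X` it is zero. -/
def indStr (N : ℕ) (X : ModuleCat.{u} R) :
    BTensor R M (∀ i : Fin (N + 1), tensorPow R M X i) →ₗ[R]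
      (∀ i : Fin (N + 1), tensorPow R M X i) :=
  LinearMap.pi <| Fin.cases 0 fun i : Fin N =>
    BTensor.map R M (LinearMap.proj (R := R)
      (φ := fun j : Fin (N + 1) => tensorPow R M X j) i.castSucc)

/-- The `T_R(M)`-module `Ind(X)`, with underlying `R`-module the (finite) direct sum of the
`M^{⊗ i} ⊗_R X`, `0 ≤ i ≤ N`, and with structure map the inclusion of
`M ⊗_R (⨁_{0 ≤ i ≤ N} M^{⊗ i} ⊗_R X) ≅ ⨁_{1 ≤ i ≤ N} M^{⊗ i} ⊗_R X`. It is used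
only for an `N`-nilpotent bimodule `M`. -/
def ind (N : ℕ) (X : ModuleCat.{u} R) : TMod R M where
  a := ModuleCat.of R (∀ i : Fin (N + 1), tensorPow R M X i)
  str := ModuleCat.ofHom (indStr R M N X)

/-- The class `Ind(𝒳) = {Ind(X) | X ∈ 𝒳}`. -/
def indClass (N : ℕ) (𝒳 : ObjectProperty (ModuleCat.{u} R)) : ObjectProperty (TMod R M) :=
  fun A => ∃ X, 𝒳 X ∧ A = ind R M N X

end Functors

section Gorenstein

variable {R : Type u} [Ring R]

/-- The complex of `R`-modules `P` is exact at every degree. -/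
def IsExactComplex (P : CochainComplex (ModuleCat.{u} R) ℤ) : Prop :=
  ∀ n : ℤ, Function.Exact (P.d (n - 1) n).hom (P.d n (n + 1)).hom

/-- The complex of abelian groups `Hom(P, X)`, that is
`⋯ → Hom(P^{n+1}, X) → Hom(P^n, X) → Hom(P^{n-1}, X) → ⋯`, is exact. -/
def IsHomExact {C : Type*} [Category C] [Preadditive C] (P : CochainComplex C ℤ) (X : C) : Prop :=
  ∀ n : ℤ, Function.Exact (fun g : P.X (n + 1) ⟶ X => P.d n (n + 1) ≫ g)
    (fun f : P.X n ⟶ X => P.d (n - 1) n ≫ f)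

/-! The following definitions are applied to `C = Mod(R)` with `U` the identity functor, and to
`C = Mod(T_R(M))` with `U` the forgetful functor. Exactness, injectivity and surjectivity are
those of the underlying maps of modules. -/

variable {C : Type*} [Category C] [Preadditive C] (U : C ⥤ ModuleCat.{u} R) [U.Additive]

/-- `P` is an `𝒳`-complete projective resolution: an exact complex of projective objects such that
`Hom(P, X)` is exact for each `X ∈ 𝒳`. -/
structure IsCompleteProjRes (𝒳 : ObjectProperty C) (P : CochainComplex C ℤ) : Prop where
  projective : ∀ n : ℤ, Projective (P.X n)
  exact : IsExactComplex ((U.mapHomologicalComplex (ComplexShape.up ℤ)).obj P)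
  hom_exact : ∀ X : C, 𝒳 X → IsHomExact P X

/-- `G` is `𝒳`-Gorenstein projective: there is an `𝒳`-complete projective resolution `P` with
`G ≅ Im(P^{-1} → P^0)`, that is, `P^{-1} → P^0` is a surjection onto `G` followed by an injection
of `G`. -/
def IsGorensteinProj (𝒳 : ObjectProperty C) : ObjectProperty C := fun G =>
  ∃ P : CochainComplex C ℤ, IsCompleteProjRes U 𝒳 P ∧
    ∃ (p : P.X (-1) ⟶ G) (j : G ⟶ P.X 0),
      Function.Surjective (U.map p).hom ∧ Function.Injective (U.map j).hom ∧ p ≫ j = P.d (-1) 0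

/-- The class `𝒳-GP(R)` of `𝒳`-Gorenstein projective `R`-modules. -/
def GP (𝒳 : ObjectProperty (ModuleCat.{u} R)) : ObjectProperty (ModuleCat.{u} R) :=
  IsGorensteinProj (𝟭 (ModuleCat.{u} R)) 𝒳

variable (M : Type u) [AddCommGroup M] [Module R M] [Module Rᵐᵒᵖ M]

/-- The class `𝒲-GP(T_R(M))` of `𝒲`-Gorenstein projective `T_R(M)`-modules. -/
def GPT (𝒲 : ObjectProperty (TMod R M)) : ObjectProperty (TMod R M) :=
  IsGorensteinProj (forgetT R M) 𝒲

/-- The class `Φ(𝒲)` of the `T_R(M)`-modules `(X, u)` with `u` injective and `coker(u) ∈ 𝒲`. -/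
def Phi (𝒲 : ObjectProperty (ModuleCat.{u} R)) : ObjectProperty (TMod R M) := fun A =>
  Function.Injective A.str.hom ∧ 𝒲 (ModuleCat.of R (A.a ⧸ LinearMap.range A.str.hom))

/-- The (`N`-nilpotent) bimodule `M` is compatible with respect to `𝒳`: for every
`Ind(𝒳)`-complete projective resolution `Q` of `T_R(M)`-modules, the complex `M ⊗_R U(Q)` is exact,
and the complex `Hom(Q, Ind(M ⊗_R X))` is exact for each `X ∈ 𝒳`. -/
def IsCompatible (N : ℕ) (𝒳 : ObjectProperty (ModuleCat.{u} R)) : Prop :=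
  ∀ Q : CochainComplex (TMod R M) ℤ, IsCompleteProjRes (forgetT R M) (indClass R M N 𝒳) Q →
    IsExactComplex
      (((forgetT R M ⋙ tensorFunctor R M).mapHomologicalComplex (ComplexShape.up ℤ)).obj Q) ∧
    ∀ X, 𝒳 X → IsHomExact Q (ind R M N ((tensorFunctor R M).obj X))

/-- The bimodule `M` is admissible with respect to `𝒳`: `Ext¹_R(G, M^{⊗ i} ⊗_R X) = 0` and
`Tor₁^R(M, M^{⊗ i} ⊗_R G) = 0` for all `G ∈ 𝒳-GP(R)`, `X ∈ 𝒳` and `i ≥ 0`. Here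
`Tor₁^R(M, -)` is the first left derived functor of `M ⊗_R -`. -/
def IsAdmissible (𝒳 : ObjectProperty (ModuleCat.{u} R)) : Prop :=
  ∀ G, GP 𝒳 G → ∀ X, 𝒳 X → ∀ i : ℕ,
    Subsingleton (Abelian.Ext G (tensorPow R M X i) 1) ∧
      Subsingleton (((tensorFunctor R M).leftDerived 1).obj (tensorPow R M G i))

end Gorenstein

end

end TensorRing

namespace TensorRing

noncomputable section

open Function

/-! ### Factorizations and `Ext`-extensions of module maps. -/

section ModuleCat

variable {R : Type u} [Ring R] {A B C D : ModuleCat.{u} R}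

/-! Nilpotence makes a pair (A, u) controlled by coker u, and Ind is left adjoint to the forgetful
functor, so every projective object is a retract of some Ind(P) with P projective.

If Q is a complete resolution over the tensor ring, its terms have injective structure maps, so 0 →
M ⊗ Q → Q → coker Q → 0 is exact in each degree. Exactness of the first two complexes passes to the
third (`coker_complex_exact`). Moreover Hom(coker Q, X) = Hom(Q, (X, 0)), and the sequence 0 → Ind(M
⊗ X) → Ind(X) → (X, 0) → 0 of `exists_ind_shift` turns compatibility into exactness of this complex
(`coker_complex_homExact`).

Conversely, the pairs with u injective and coker u Gorenstein projective are closed under syzygies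
and cosyzygies whose middle term is Ind(P) (`exists_syzygy`, `exists_cosyzygy`), and these splice to
a complete resolution (`gorensteinProj_of_isSyzygy`). Hom into Ind(X) stays exact by
`exists_extension_to_ind`: a morphism to Ind(X) is a compatible sequence of maps to M^k ⊗ X,
extended one degree at a time with obstructions in Ext¹(G, M^k ⊗ X), where G is the cokernel on the
right. Vanishing Tor keeps the sequences of cokernels exact under M^k ⊗ -, and comparisons are then
made by descending induction on k, starting from M^(N+1) ⊗ A = 0. -/

lemma hom_hom_of_comp_eq {f : A ⟶ B} {g : B ⟶ C} {h : A ⟶ C} (e : f ≫ g = h) (x : A) :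
    g.hom (f.hom x) = h.hom x := by
  rw [← e]; rfl

lemma hom_hom_of_comp_eq_zero {f : A ⟶ B} {g : B ⟶ C} (e : f ≫ g = 0) (x : A) :
    g.hom (f.hom x) = 0 := by
  rw [hom_hom_of_comp_eq e]; rfl

lemma hom_hom_of_square {f : A ⟶ B} {g : B ⟶ D} {h : A ⟶ C} {k : C ⟶ D} (e : f ≫ g = h ≫ k)
    (x : A) : g.hom (f.hom x) = k.hom (h.hom x) := by
  rw [hom_hom_of_comp_eq e]; rfl

lemma modHom_ext {f g : A ⟶ B} (h : ∀ x, f.hom x = g.hom x) : f = g :=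
  ModuleCat.hom_ext (LinearMap.ext h)

/-- A map that vanishes on the kernel of a surjection factors through it. -/
lemma exists_desc (g : A ⟶ B) (hg : Surjective g.hom) (φ : A ⟶ C)
    (h : ∀ x, g.hom x = 0 → φ.hom x = 0) : ∃ ψ : B ⟶ C, g ≫ ψ = φ := by
  let e := g.hom.quotKerEquivOfSurjective hg
  have hle : LinearMap.ker g.hom ≤ LinearMap.ker φ.hom := h
  refine ⟨ModuleCat.ofHom ((Submodule.liftQ (LinearMap.ker g.hom) φ.hom hle) ∘ₗ
    e.symm.toLinearMap), modHom_ext fun x => ?_⟩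
  have : e.symm (g.hom x) = Submodule.Quotient.mk x := by
    rw [LinearEquiv.symm_apply_eq]; rfl
  change Submodule.liftQ (LinearMap.ker g.hom) φ.hom hle (e.symm (g.hom x)) = _
  rw [this]
  rfl

/-- A map that lands in the image of an injection factors through it. -/
lemma exists_lift (i : B ⟶ C) (hi : Injective i.hom) (φ : A ⟶ C)
    (h : ∀ x, ∃ y, i.hom y = φ.hom x) : ∃ ψ : A ⟶ B, ψ ≫ i = φ := by
  let e := LinearEquiv.ofInjective i.hom hi
  refine ⟨ModuleCat.ofHom (e.symm.toLinearMap ∘ₗ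
    LinearMap.codRestrict (LinearMap.range i.hom) φ.hom h), modHom_ext fun x => ?_⟩
  change i.hom (e.symm ⟨φ.hom x, h x⟩) = _
  obtain ⟨y, hy⟩ := h x
  have : e y = ⟨φ.hom x, h x⟩ := Subtype.ext hy
  rw [← this, LinearEquiv.symm_apply_apply, hy]

/-- A short exact sequence of modules. -/
structure IsSES (f : A ⟶ B) (g : B ⟶ C) : Prop where
  inj : Injective f.hom
  exact : Exact f.hom g.hom
  surj : Surjective g.hom

lemma IsSES.zero {f : A ⟶ B} {g : B ⟶ C} (h : IsSES f g) : f ≫ g = 0 :=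
  modHom_ext h.exact.apply_apply_eq_zero

/-- Maps to a module with vanishing `Ext¹` extend. -/
lemma exists_extension_of_ext {Y : ModuleCat.{u} R} (hE : Subsingleton (Abelian.Ext C Y 1))
    (s : A ⟶ B) (t : B ⟶ C) (hst : Exact s.hom t.hom) (ht : Surjective t.hom) (φ : A ⟶ Y)
    (hφ : ∀ x, s.hom x = 0 → φ.hom x = 0) : ∃ ψ : B ⟶ Y, s ≫ ψ = φ := by
  let I : ModuleCat.{u} R := ModuleCat.of R (LinearMap.range s.hom)
  let p : A ⟶ I := ModuleCat.ofHom s.hom.rangeRestrict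
  let i : I ⟶ B := ModuleCat.ofHom (LinearMap.range s.hom).subtype
  have hp : Surjective p.hom := s.hom.surjective_rangeRestrict
  have hi : Injective i.hom := Subtype.val_injective
  have hit : Exact i.hom t.hom := fun y => by
    rw [hst y]
    exact ⟨fun ⟨x, hx⟩ => ⟨⟨y, x, hx⟩, rfl⟩, fun ⟨⟨_, x, hx⟩, e⟩ => ⟨x, hx.trans e⟩⟩
  obtain ⟨φ', hφ'⟩ := exists_desc p hp φ fun x hx => hφ x (congrArg Subtype.val hx)
  let S : ShortComplex (ModuleCat.{u} R) :=
    ShortComplex.mk i t (modHom_ext hit.apply_apply_eq_zero)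
  have hS : S.ShortExact :=
    { exact := (ShortComplex.ShortExact.moduleCat_exact_iff_function_exact S).2 hit
      mono_f := (ModuleCat.mono_iff_injective _).2 hi
      epi_g := (ModuleCat.epi_iff_surjective _).2 ht }
  obtain ⟨x₂, hx₂⟩ := Abelian.Ext.contravariant_sequence_exact₁ hS Y
    (Abelian.Ext.mk₀ φ') (add_zero 1) (Subsingleton.elim (α := Abelian.Ext C Y 1) _ _)
  obtain ⟨ψ, rfl⟩ := Abelian.Ext.addEquiv₀.symm.surjective x₂
  refine ⟨ψ, ?_⟩
  have h2 : i ≫ ψ = φ' := by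
    apply Abelian.Ext.addEquiv₀.symm.injective
    change Abelian.Ext.mk₀ (i ≫ ψ) = Abelian.Ext.mk₀ φ'
    rw [← Abelian.Ext.mk₀_comp_mk₀]
    exact hx₂
  rw [← hφ', ← h2]
  rfl

end ModuleCat

/-! ### Right exactness, Tor₁ and nilpotence for M ⊗ -. -/

section Tensor

variable (R : Type u) [Ring R] (M : Type u) [AddCommGroup M] [Module R M] [Module Rᵐᵒᵖ M]
variable {A B C D : ModuleCat.{u} R}

local notation "𝔽" => tensorFunctor R M

/-- Each generating relation lifts along a surjection; this is what lets right exactness descend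
from ⊗ over ℤ to ⊗ over R. -/
lemma balancing_le_map {f : A ⟶ B} (hf : Surjective f.hom) :
    balancing R M B ≤ (balancing R M A).map
      (TensorProduct.AlgebraTensorModule.map (LinearMap.id : M →ₗ[R] M)
        f.hom.toAddMonoidHom.toIntLinearMap) := by
  refine Submodule.span_le.2 ?_
  rintro _ ⟨m, r, y, rfl⟩
  obtain ⟨x, rfl⟩ := hf y
  exact ⟨_, Submodule.subset_span ⟨m, r, x, rfl⟩, by simp⟩

lemma tensor_surjective {f : A ⟶ B} (hf : Surjective f.hom) :
    Surjective ((𝔽).map f).hom := by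
  intro y
  obtain ⟨y, rfl⟩ := Submodule.Quotient.mk_surjective _ y
  obtain ⟨x, rfl⟩ := LinearMap.lTensor_surjective (R := ℤ) M
    (g := f.hom.toAddMonoidHom.toIntLinearMap) hf y
  exact ⟨Submodule.Quotient.mk x, rfl⟩

lemma tensor_exact {f : A ⟶ B} {g : B ⟶ C} (hfg : Exact f.hom g.hom)
    (hg : Surjective g.hom) : Exact ((𝔽).map f).hom ((𝔽).map g).hom := by
  intro y
  constructor
  · intro hy
    obtain ⟨y, rfl⟩ := Submodule.Quotient.mk_surjective _ y
    -- The image of y is only a relation, not zero; subtracting a relation z with the same image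
    -- gives an element killed over ℤ.
    obtain ⟨z, hz, hzy⟩ := balancing_le_map R M hg
      ((Submodule.Quotient.mk_eq_zero (balancing R M C)).1 hy)
    have key : LinearMap.lTensor M g.hom.toAddMonoidHom.toIntLinearMap (y - z) = 0 := by
      rw [map_sub, sub_eq_zero]
      exact hzy.symm
    obtain ⟨x, hx⟩ := (lTensor_exact (R := ℤ) M (f := f.hom.toAddMonoidHom.toIntLinearMap)
      (g := g.hom.toAddMonoidHom.toIntLinearMap) hfg hg (y - z)).1 key
    refine ⟨Submodule.Quotient.mk x, ?_⟩
    have : (Submodule.Quotient.mk (y - z) : BTensor R M B) = Submodule.Quotient.mk y := by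
      rw [Submodule.Quotient.eq]
      simpa using hz
    rw [← this, ← hx]
    rfl
  · rintro ⟨x, rfl⟩
    have h : f ≫ g = 0 := modHom_ext hfg.apply_apply_eq_zero
    exact hom_hom_of_comp_eq_zero (by rw [← (𝔽).map_comp, h, (𝔽).map_zero]) x

/-- `C` has vanishing `Tor₁(M, C)`, in terms of short exact sequences. -/
def TensorPreserves (C : ModuleCat.{u} R) : Prop :=
  ∀ ⦃A B : ModuleCat.{u} R⦄ (f : A ⟶ B) (g : B ⟶ C), IsSES f g → Injective ((𝔽).map f).hom

/-- Comparing a projective resolution P of C with the given sequence presents B as the cokernel of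
(-k, d) : P₁ → A ⊕ P₀. An element of M ⊗ A dying in M ⊗ B therefore comes from a cycle in M ⊗ P₁.
Vanishing Tor₁ makes it a boundary from M ⊗ P₂, and k kills boundaries. -/
lemma tensorPreserves_of_subsingleton (h : Subsingleton (((𝔽).leftDerived 1).obj C)) :
    TensorPreserves R M C := by
  intro A B f g hfg
  let P := ProjectiveResolution.of C
  have hex : Exact ((𝔽).map (P.complex.d 2 1)).hom ((𝔽).map (P.complex.d 1 0)).hom := by
    have hz : Limits.IsZero (((𝔽).leftDerived 1).obj C) :=
      (ModuleCat.isZero_iff_subsingleton).2 h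
    have hz' := hz.of_iso (P.isoLeftDerivedObj (𝔽) 1).symm
    have := (HomologicalComplex.exactAt_iff_isZero_homology _ _).2 hz'
    rw [HomologicalComplex.exactAt_iff' _ 2 1 0 (by simp) (by simp)] at this
    exact (ShortComplex.ShortExact.moduleCat_exact_iff_function_exact _).1 this
  let π : P.complex.X 0 ⟶ C := P.π.f 0 ≫ (HomologicalComplex.singleObjXSelf _ _ _).hom
  have hπ : Surjective π.hom := by
    rw [← ModuleCat.epi_iff_surjective]
    infer_instance
  have hdπ : Exact (P.complex.d 1 0).hom π.hom := by
    have h0 := (ShortComplex.ShortExact.moduleCat_exact_iff_function_exact _).1 P.exact₀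
    intro y
    rw [← h0 y]
    have hinj : Injective (HomologicalComplex.singleObjXSelf (ComplexShape.down ℕ) 0 C).hom.hom :=
      (ModuleCat.mono_iff_injective _).1 inferInstance
    exact map_eq_zero_iff _ hinj
  have : Epi g := (ModuleCat.epi_iff_surjective _).2 hfg.surj
  let l : P.complex.X 0 ⟶ B := Projective.factorThru π g
  have hl : l ≫ g = π := Projective.factorThru_comp π g
  obtain ⟨k, hk⟩ := exists_lift f hfg.inj (P.complex.d 1 0 ≫ l) fun x => by
    rw [← Set.mem_range, ← hfg.exact]
    change g.hom (l.hom ((P.complex.d 1 0).hom x)) = 0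
    rw [hom_hom_of_comp_eq hl]
    exact hdπ.apply_apply_eq_zero x
  have hdk : P.complex.d 2 1 ≫ k = 0 := modHom_ext fun x => hfg.inj <| by
    change f.hom (k.hom ((P.complex.d 2 1).hom x)) = f.hom 0
    rw [hom_hom_of_comp_eq hk, map_zero]
    change l.hom ((P.complex.d 1 0).hom ((P.complex.d 2 1).hom x)) = 0
    rw [hom_hom_of_comp_eq_zero (P.complex.d_comp_d 2 1 0), map_zero]
  let AP : ModuleCat.{u} R := ModuleCat.of R (A × P.complex.X 0)
  let i₁ : A ⟶ AP := ModuleCat.ofHom (LinearMap.inl R A (P.complex.X 0))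
  let p₁ : AP ⟶ A := ModuleCat.ofHom (LinearMap.fst R A (P.complex.X 0))
  let p₂ : AP ⟶ P.complex.X 0 := ModuleCat.ofHom (LinearMap.snd R A (P.complex.X 0))
  let α : P.complex.X 1 ⟶ AP := ModuleCat.ofHom (LinearMap.prod (-k.hom) (P.complex.d 1 0).hom)
  let β : AP ⟶ B := ModuleCat.ofHom (LinearMap.coprod f.hom l.hom)
  have hβ : Surjective β.hom := fun b => by
    obtain ⟨p, hp⟩ := hπ (g.hom b)
    have : g.hom (b - l.hom p) = 0 := by
      rw [map_sub, hom_hom_of_comp_eq hl, hp, sub_self]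
    obtain ⟨a, ha⟩ := (hfg.exact _).1 this
    refine ⟨(a, p), ?_⟩
    change f.hom a + l.hom p = b
    rw [ha, sub_add_cancel]
  have hαβ : Exact α.hom β.hom := by
    intro y
    constructor
    · obtain ⟨a, p⟩ := y
      intro (hy : f.hom a + l.hom p = 0)
      have hp : π.hom p = 0 := by
        have := congrArg g.hom hy
        rwa [map_add, hfg.exact.apply_apply_eq_zero, zero_add, map_zero,
          hom_hom_of_comp_eq hl] at this
      obtain ⟨q, rfl⟩ := (hdπ _).1 hp
      refine ⟨q, Prod.ext (hfg.inj ?_) rfl⟩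
      change f.hom (- k.hom q) = f.hom a
      rw [map_neg, hom_hom_of_comp_eq hk, eq_neg_of_add_eq_zero_left hy]
      rfl
    · rintro ⟨q, rfl⟩
      change f.hom (- k.hom q) + l.hom ((P.complex.d 1 0).hom q) = 0
      rw [map_neg, hom_hom_of_comp_eq hk]
      exact neg_add_cancel _
  have hF := tensor_exact R M hαβ hβ
  rw [injective_iff_map_eq_zero]
  intro a ha
  have hiβ : i₁ ≫ β = f := modHom_ext fun x => by
    change f.hom x + l.hom 0 = f.hom x
    simp
  have h1 : ((𝔽).map β).hom (((𝔽).map i₁).hom a) = 0 := by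
    rw [hom_hom_of_comp_eq (h := (𝔽).map f) (by rw [← (𝔽).map_comp, hiβ]), ha]
  obtain ⟨q, hq⟩ := (hF _).1 h1
  have hip₂ : i₁ ≫ p₂ = 0 := rfl
  have hip₁ : i₁ ≫ p₁ = 𝟙 A := rfl
  have hαp₁ : α ≫ p₁ = -k := rfl
  have hαp₂ : α ≫ p₂ = P.complex.d 1 0 := rfl
  have h2 : ((𝔽).map (P.complex.d 1 0)).hom q = 0 := by
    rw [← hαp₂, (𝔽).map_comp]
    change ((𝔽).map p₂).hom (((𝔽).map α).hom q) = 0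
    rw [hq]
    exact hom_hom_of_comp_eq_zero (by rw [← (𝔽).map_comp, hip₂, (𝔽).map_zero]) a
  obtain ⟨w, rfl⟩ := (hex _).1 h2
  have h3 : ((𝔽).map p₁).hom (((𝔽).map i₁).hom a) = a := by
    rw [hom_hom_of_comp_eq (h := 𝟙 _) (by rw [← (𝔽).map_comp, hip₁, (𝔽).map_id])]
    rfl
  rw [← h3, ← hq, hom_hom_of_comp_eq (h := (𝔽).map (-k)) (by rw [← (𝔽).map_comp, hαp₁])]
  refine hom_hom_of_comp_eq_zero ?_ w
  rw [← (𝔽).map_comp, Preadditive.comp_neg, hdk, neg_zero, (𝔽).map_zero]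

variable {R}

/-- Given K → L → B, the preimage L' of A in L splits K → L into two inclusions, with quotients A
and C; each stays injective. -/
lemma tensorPreserves_extension {f : A ⟶ B} {g : B ⟶ C} (h : IsSES f g)
    (hA : TensorPreserves R M A) (hC : TensorPreserves R M C) : TensorPreserves R M B := by
  intro K L i p hip
  let L' : ModuleCat.{u} R := ModuleCat.of R (LinearMap.ker (p ≫ g).hom)
  let j : L' ⟶ L := ModuleCat.ofHom (LinearMap.ker (p ≫ g).hom).subtype
  have hj : IsSES j (p ≫ g) := ⟨Subtype.val_injective,
    fun x => ⟨fun hx => ⟨⟨x, hx⟩, rfl⟩, fun ⟨y, hy⟩ => hy ▸ y.2⟩, h.surj.comp hip.surj⟩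
  obtain ⟨i', hi'⟩ := exists_lift j hj.inj i fun x => ⟨⟨i.hom x, by
    change g.hom (p.hom (i.hom x)) = 0
    rw [hip.exact.apply_apply_eq_zero, map_zero]⟩, rfl⟩
  obtain ⟨p', hp'⟩ := exists_lift f h.inj (j ≫ p) fun x => (h.exact _).1 x.2
  have hS : IsSES i' p' := by
    refine ⟨?_, fun x => ⟨fun hx => ?_, ?_⟩, fun a => ?_⟩
    · have := hip.inj
      rw [← hi'] at this
      exact Injective.of_comp (f := j.hom) this
    · have hx' : p.hom (j.hom x) = 0 := by
        have := hom_hom_of_comp_eq hp' x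
        rw [hx, map_zero] at this
        exact this.symm
      obtain ⟨k, hk⟩ := (hip.exact _).1 hx'
      exact ⟨k, hj.inj ((hom_hom_of_comp_eq hi' k).trans hk)⟩
    · rintro ⟨k, rfl⟩
      refine h.inj ?_
      rw [hom_hom_of_comp_eq hp', map_zero]
      change p.hom (j.hom (i'.hom k)) = 0
      rw [hom_hom_of_comp_eq hi', hip.exact.apply_apply_eq_zero]
    · obtain ⟨x, hx⟩ := hip.surj (f.hom a)
      refine ⟨⟨x, ?_⟩, h.inj ?_⟩
      · change g.hom (p.hom x) = 0
        rw [hx, h.exact.apply_apply_eq_zero]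
      · rw [hom_hom_of_comp_eq hp']
        exact hx
  have := (hC _ _ hj).comp (hA _ _ hS)
  rw [← hi', (𝔽).map_comp]
  exact this

lemma tensorPreserves_of_subsingleton_obj (h : Subsingleton C) : TensorPreserves R M C := by
  intro K L i p hip
  have hs : Surjective i.hom := fun y => (hip.exact y).1 (Subsingleton.elim _ _)
  have : IsIso i := (ConcreteCategory.isIso_iff_bijective i).2 ⟨hip.inj, hs⟩
  exact (ModuleCat.mono_iff_injective _).1 inferInstance

lemma isSES_tensor {f : A ⟶ B} {g : B ⟶ C} (h : IsSES f g) (hC : TensorPreserves R M C) :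
    IsSES ((𝔽).map f) ((𝔽).map g) :=
  ⟨hC f g h, tensor_exact R M h.exact h.surj, tensor_surjective R M h.surj⟩

variable (R)

/-- The functor `M^{⊗ k} ⊗_R -`. -/
def powFunctor : ℕ → (ModuleCat.{u} R ⥤ ModuleCat.{u} R)
  | 0 => 𝟭 _
  | k + 1 => powFunctor k ⋙ 𝔽

lemma powFunctor_obj (X : ModuleCat.{u} R) (k : ℕ) :
    (powFunctor R M k).obj X = tensorPow R M X k := by
  induction k with
  | zero => rfl
  | succ k ih => exact congrArg (𝔽).obj ih

/-- Peels off the innermost factor, so that M^k ⊗ u can be read as a map from M^(k+1) ⊗ A in the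
descending inductions. -/
lemma powFunctor_succ' (k : ℕ) : powFunctor R M (k + 1) = 𝔽 ⋙ powFunctor R M k := by
  induction k with
  | zero => rfl
  | succ k ih =>
    exact congrArg (· ⋙ 𝔽) ih

lemma powFunctor_surjective {f : A ⟶ B} (hf : Surjective f.hom) (k : ℕ) :
    Surjective ((powFunctor R M k).map f).hom := by
  induction k with
  | zero => exact hf
  | succ k ih => exact tensor_surjective R M ih

/-- X is covered by the maps r ↦ r x out of R, and tensoring preserves joint generation. Nilpotence,
stated for R, thus reaches every X without an associativity isomorphism. -/
lemma iSup_range_powFunctor (X : ModuleCat.{u} R) (k : ℕ) :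
    ⨆ x : X, LinearMap.range ((powFunctor R M k).map
      (ModuleCat.ofHom (LinearMap.toSpanSingleton R X x) : ModuleCat.of R R ⟶ X)).hom = ⊤ := by
  induction k with
  | zero =>
    rw [eq_top_iff]
    intro x _
    exact Submodule.mem_iSup_of_mem x ⟨(1 : R), one_smul R x⟩
  | succ k ih =>
    rw [eq_top_iff]
    rintro t -
    obtain ⟨t, rfl⟩ := Submodule.Quotient.mk_surjective _ t
    induction t using TensorProduct.induction_on with
    | zero => exact zero_mem _
    | add a b ha hb => exact add_mem ha hb
    | tmul m y =>
      have hy : y ∈ ⨆ x : X, LinearMap.range ((powFunctor R M k).map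
        (ModuleCat.ofHom (LinearMap.toSpanSingleton R X x) : ModuleCat.of R R ⟶ X)).hom :=
        ih ▸ Submodule.mem_top
      induction hy using Submodule.iSup_induction' with
      | zero => rw [TensorProduct.tmul_zero]; exact zero_mem _
      | add a b _ _ ha hb => rw [TensorProduct.tmul_add]; exact add_mem ha hb
      | mem x y hy =>
        obtain ⟨z, rfl⟩ := hy
        exact Submodule.mem_iSup_of_mem x ⟨Submodule.Quotient.mk (m ⊗ₜ[ℤ] z), rfl⟩

variable {R M}

lemma subsingleton_powFunctor {N : ℕ} (hN : IsNilpotentBimodule R M N) (X : ModuleCat.{u} R) :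
    Subsingleton ((powFunctor R M (N + 1)).obj X) := by
  have h0 : Subsingleton ((powFunctor R M (N + 1)).obj (ModuleCat.of R R)) := by
    rw [powFunctor_obj]; exact hN
  have h := iSup_range_powFunctor R M X (N + 1)
  have h1 : ∀ x : X, LinearMap.range ((powFunctor R M (N + 1)).map
      (ModuleCat.ofHom (LinearMap.toSpanSingleton R X x) : ModuleCat.of R R ⟶ X)).hom = ⊥ := by
    intro x
    rw [LinearMap.range_eq_bot]
    exact LinearMap.ext fun r => by rw [Subsingleton.elim r 0, map_zero, map_zero]
  simp only [h1, iSup_bot] at h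
  exact (Submodule.subsingleton_iff R).1 ⟨subsingleton_of_bot_eq_top h |>.elim⟩

lemma subsingleton_tensorPow {N : ℕ} (hN : IsNilpotentBimodule R M N) (X : ModuleCat.{u} R) :
    Subsingleton (tensorPow R M X (N + 1)) := by
  rw [← powFunctor_obj]
  exact subsingleton_powFunctor hN X

end Tensor

/-! ### Morphisms, kernels and cokernels over the tensor ring. -/

section TMod

variable {R : Type u} [Ring R] {M : Type u} [AddCommGroup M] [Module R M] [Module Rᵐᵒᵖ M]

local notation "𝔽" => tensorFunctor R M

variable {A B C : TMod R M}

lemma hom_str (f : A ⟶ B) (x : (𝔽).obj A.a) :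
    f.f.hom (A.str.hom x) = B.str.hom (((𝔽).map f.f).hom x) :=
  hom_hom_of_square f.h.symm x

lemma tmod_hom_ext {f g : A ⟶ B} (h : ∀ x, f.f.hom x = g.f.hom x) : f = g :=
  Endofunctor.Algebra.Hom.ext (modHom_ext h)

lemma tmod_comp_apply {f : A ⟶ B} {g : B ⟶ C} {h : A ⟶ C} (e : f ≫ g = h) (x : A.a) :
    g.f.hom (f.f.hom x) = h.f.hom x := by
  rw [← e]; rfl

lemma tmod_exists_desc (g : A ⟶ B) (hg : Surjective g.f.hom) (φ : A ⟶ C)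
    (h : ∀ x, g.f.hom x = 0 → φ.f.hom x = 0) : ∃ ψ : B ⟶ C, g ≫ ψ = φ := by
  obtain ⟨ψ, hψ⟩ := exists_desc g.f hg φ.f h
  refine ⟨⟨ψ, modHom_ext fun y => ?_⟩, Endofunctor.Algebra.Hom.ext hψ⟩
  obtain ⟨x, rfl⟩ := tensor_surjective R M hg y
  change C.str.hom (((𝔽).map ψ).hom (((𝔽).map g.f).hom x)) = ψ.hom (B.str.hom _)
  rw [← hom_str, hom_hom_of_comp_eq hψ, hom_str φ,
    hom_hom_of_comp_eq (h := (𝔽).map φ.f) (by rw [← (𝔽).map_comp, hψ])]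

lemma tmod_exists_lift (i : B ⟶ C) (hi : Injective i.f.hom) (φ : A ⟶ C)
    (h : ∀ x, ∃ y, i.f.hom y = φ.f.hom x) : ∃ ψ : A ⟶ B, ψ ≫ i = φ := by
  obtain ⟨ψ, hψ⟩ := exists_lift i.f hi φ.f h
  refine ⟨⟨ψ, modHom_ext fun x => hi ?_⟩, Endofunctor.Algebra.Hom.ext hψ⟩
  change i.f.hom (B.str.hom (((𝔽).map ψ).hom x)) = i.f.hom (ψ.hom (A.str.hom x))
  rw [hom_str, hom_hom_of_comp_eq hψ, hom_str φ,
    hom_hom_of_comp_eq (h := (𝔽).map φ.f) (by rw [← (𝔽).map_comp, hψ])]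

/-- Right exactness of M ⊗ - is what makes the structure map descend to the quotient. -/
lemma exists_cokernel (e : A ⟶ B) :
    ∃ (D : TMod R M) (q : B ⟶ D), Surjective q.f.hom ∧ Exact e.f.hom q.f.hom := by
  let D₀ : ModuleCat.{u} R := ModuleCat.of R (B.a ⧸ LinearMap.range e.f.hom)
  let q : B.a ⟶ D₀ := ModuleCat.ofHom (LinearMap.range e.f.hom).mkQ
  have hq : Surjective q.hom := Submodule.mkQ_surjective _
  have hex : Exact e.f.hom q.hom := LinearMap.exact_map_mkQ_range e.f.hom
  obtain ⟨s, hs⟩ := exists_desc ((𝔽).map q) (tensor_surjective R M hq) (B.str ≫ q) fun x hx => by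
    obtain ⟨y, rfl⟩ := (tensor_exact R M hex hq x).1 hx
    change q.hom (B.str.hom (((𝔽).map e.f).hom y)) = 0
    rw [← hom_str, hex.apply_apply_eq_zero]
  exact ⟨⟨D₀, s⟩, ⟨q, hs⟩, hq, hex⟩

lemma exists_kernel (e : A ⟶ B) :
    ∃ (K : TMod R M) (i : K ⟶ A), Injective i.f.hom ∧ Exact i.f.hom e.f.hom := by
  let K₀ : ModuleCat.{u} R := ModuleCat.of R (LinearMap.ker e.f.hom)
  let i : K₀ ⟶ A.a := ModuleCat.ofHom (LinearMap.ker e.f.hom).subtype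
  have hi : Injective i.hom := Subtype.val_injective
  have hie : i ≫ e.f = 0 := modHom_ext fun x => x.2
  obtain ⟨s, hs⟩ := exists_lift i hi ((𝔽).map i ≫ A.str) fun x => ⟨⟨_, by
    change e.f.hom (A.str.hom (((𝔽).map i).hom x)) = 0
    rw [hom_str, hom_hom_of_comp_eq_zero (f := (𝔽).map i) (g := (𝔽).map e.f)
      (by rw [← (𝔽).map_comp, hie, (𝔽).map_zero]), map_zero]⟩,
      rfl⟩
  exact ⟨⟨K₀, s⟩, ⟨i, hs.symm⟩, hi, fun x => ⟨fun hx => ⟨⟨x, hx⟩, rfl⟩, fun ⟨y, hy⟩ => hy ▸ y.2⟩⟩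

lemma tmod_epi_of_surjective (e : A ⟶ B) (he : Surjective e.f.hom) : Epi e :=
  have : Epi e.f := (ModuleCat.epi_iff_surjective _).2 he
  Endofunctor.Algebra.epi_of_epi e

lemma surjective_of_tmod_epi (e : A ⟶ B) [Epi e] : Surjective e.f.hom := by
  obtain ⟨D, q, hq, hex⟩ := exists_cokernel e
  have h0 : q = 0 := by
    rw [← cancel_epi e]
    exact tmod_hom_ext hex.apply_apply_eq_zero
  intro y
  rw [← Set.mem_range, ← hex, h0]
  rfl

/-- The functor `(A, u) ↦ coker u`. -/
def cokerFunctor (R : Type u) [Ring R] (M : Type u) [AddCommGroup M] [Module R M]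
    [Module Rᵐᵒᵖ M] : TMod R M ⥤ ModuleCat.{u} R where
  obj A := ModuleCat.of R (A.a ⧸ LinearMap.range A.str.hom)
  map {A B} f := ModuleCat.ofHom (Submodule.mapQ _ _ f.f.hom (by
    rintro _ ⟨x, rfl⟩
    exact ⟨_, (hom_str f x).symm⟩))
  map_id A := modHom_ext fun x => by
    obtain ⟨x, rfl⟩ := Submodule.Quotient.mk_surjective _ x
    rfl
  map_comp f g := modHom_ext fun x => by
    obtain ⟨x, rfl⟩ := Submodule.Quotient.mk_surjective _ x
    rfl

instance : (cokerFunctor R M).Additive where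
  map_add {A B f g} := modHom_ext fun x => by
    obtain ⟨x, rfl⟩ := Submodule.Quotient.mk_surjective _ x
    rfl

/-- The projection `A → coker u`. -/
def cokerπ (A : TMod R M) : A.a ⟶ (cokerFunctor R M).obj A :=
  ModuleCat.ofHom (LinearMap.range A.str.hom).mkQ

lemma cokerπ_surjective (A : TMod R M) : Surjective (cokerπ A).hom := Submodule.mkQ_surjective _

lemma cokerπ_exact (A : TMod R M) : Exact A.str.hom (cokerπ A).hom :=
  LinearMap.exact_map_mkQ_range A.str.hom

lemma cokerπ_naturality (f : A ⟶ B) :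
    cokerπ A ≫ (cokerFunctor R M).map f = f.f ≫ cokerπ B := rfl

lemma str_comp_cokerπ (A : TMod R M) : A.str ≫ cokerπ A = 0 :=
  modHom_ext (cokerπ_exact A).apply_apply_eq_zero

/-! ### The induced modules Ind(X) and projective objects. -/

section Ind

variable {N : ℕ} (X : ModuleCat.{u} R)

/-- The projection of `Ind(X)` to a summand. -/
def indProj (i : Fin (N + 1)) : (ind R M N X).a ⟶ tensorPow R M X i :=
  ModuleCat.ofHom (LinearMap.proj (R := R) (φ := fun j : Fin (N + 1) => tensorPow R M X j) i)

/-- The inclusion of a summand into `Ind(X)`. -/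
def indIncl (i : Fin (N + 1)) : tensorPow R M X i ⟶ (ind R M N X).a :=
  ModuleCat.ofHom (LinearMap.single R (fun j : Fin (N + 1) => tensorPow R M X j) i)

/-- The projection of `Ind(X)` to `X`. -/
def indTop : (ind R M N X).a ⟶ X := indProj (N := N) X 0

/-- The inclusion of `X` into `Ind(X)`. -/
def indUnit : X ⟶ (ind R M N X).a := indIncl (N := N) X 0

variable {X}

lemma ind_ext {x y : (ind R M N X).a} (h : ∀ i, (indProj X i).hom x = (indProj X i).hom y) :
    x = y := funext h

lemma ind_hom_ext {Y : ModuleCat.{u} R} {f g : Y ⟶ (ind R M N X).a}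
    (h : ∀ i, f ≫ indProj X i = g ≫ indProj X i) : f = g :=
  modHom_ext fun x => ind_ext fun i => by rw [hom_hom_of_comp_eq (h i)]; rfl

lemma indIncl_indProj_self (i : Fin (N + 1)) :
    indIncl (R := R) (M := M) X i ≫ indProj X i = 𝟙 _ := modHom_ext fun x =>
  Pi.single_eq_same (M := fun j : Fin (N + 1) => tensorPow R M X j) i x

lemma indIncl_indProj_ne {i j : Fin (N + 1)} (h : j ≠ i) :
    indIncl (R := R) (M := M) X i ≫ indProj X j = 0 := modHom_ext fun x =>
  Pi.single_eq_of_ne (M := fun j : Fin (N + 1) => tensorPow R M X j) h x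

lemma sum_indProj_indIncl :
    ∑ i : Fin (N + 1), indProj (R := R) (M := M) X i ≫ indIncl X i = 𝟙 _ := by
  refine ind_hom_ext fun j => ?_
  rw [Preadditive.sum_comp, Finset.sum_eq_single j]
  · rw [Category.assoc, indIncl_indProj_self, Category.comp_id, Category.id_comp]
  · intro i _ hi
    rw [Category.assoc, indIncl_indProj_ne hi.symm, Limits.comp_zero]
  · simp

lemma indUnit_indTop : indUnit (M := M) (N := N) X ≫ indTop X = 𝟙 X := indIncl_indProj_self 0

lemma ind_str_proj_zero : (ind R M N X).str ≫ indProj X 0 = 0 := rfl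

lemma ind_str_proj_succ (i : Fin N) :
    (ind R M N X).str ≫ indProj X i.succ = (𝔽).map (indProj X i.castSucc) := rfl

lemma indIncl_succ (i : Fin N) :
    indIncl (R := R) (M := M) X i.succ = (𝔽).map (indIncl X i.castSucc) ≫ (ind R M N X).str := by
  refine modHom_ext fun x => ind_ext fun j => ?_
  change _ = ((ind R M N X).str ≫ indProj X j).hom (((𝔽).map (indIncl X i.castSucc)).hom x)
  induction j using Fin.cases with
  | zero => exact hom_hom_of_comp_eq_zero (indIncl_indProj_ne (Fin.succ_ne_zero i).symm) x
  | succ j =>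
    rw [ind_str_proj_succ]
    have h2 := hom_hom_of_comp_eq
      ((𝔽).map_comp (indIncl (M := M) X i.castSucc) (indProj (M := M) X j.castSucc)).symm
    refine Eq.trans ?_ (h2 x).symm
    by_cases h : j = i
    · subst h
      rw [indIncl_indProj_self, (𝔽).map_id]
      exact hom_hom_of_comp_eq (indIncl_indProj_self j.succ) x
    · rw [indIncl_indProj_ne (by simpa using h), (𝔽).map_zero]
      exact hom_hom_of_comp_eq_zero (indIncl_indProj_ne (by simpa using h)) x

/-- Uniqueness half of the adjunction: by `indIncl_succ` the summand X generates all others through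
the structure map. -/
lemma ind_hom_eq_of_unit {f g : ind R M N X ⟶ A}
    (h : indUnit X ≫ f.f = indUnit X ≫ g.f) : f = g := by
  have key : ∀ i : Fin (N + 1), indIncl X i ≫ f.f = indIncl X i ≫ g.f := by
    intro i
    induction i using Fin.induction with
    | zero => exact h
    | succ i ih =>
      have h2 : ((𝔽).map (indIncl X i.castSucc) ≫ (ind R M N X).str) ≫ f.f =
          ((𝔽).map (indIncl X i.castSucc) ≫ (ind R M N X).str) ≫ g.f := by
        rw [Category.assoc, Category.assoc, ← f.h, ← g.h, ← (𝔽).map_comp_assoc,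
          ← (𝔽).map_comp_assoc, ih]
      rw [indIncl_succ]
      exact h2
  refine Endofunctor.Algebra.Hom.ext ?_
  rw [← Category.id_comp f.f, ← Category.id_comp g.f, ← sum_indProj_indIncl,
    Preadditive.sum_comp, Preadditive.sum_comp]
  exact Finset.sum_congr rfl fun i _ => by rw [Category.assoc, Category.assoc, key]

lemma subsingleton_tensorPow_of_le (hN : IsNilpotentBimodule R M N) {k : ℕ} (hk : N + 1 ≤ k) :
    Subsingleton (tensorPow R M X k) := by
  induction k, hk using Nat.le_induction with
  | base => exact subsingleton_tensorPow hN X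
  | succ k _ ih =>
    refine ModuleCat.isZero_iff_subsingleton.1 ?_
    exact (𝔽).map_isZero (ModuleCat.isZero_iff_subsingleton.2 ih)

lemma modHom_eq_of_subsingleton {A B : ModuleCat.{u} R} (h : Subsingleton B) (f g : A ⟶ B) :
    f = g :=
  modHom_ext fun _ => Subsingleton.elim _ _

lemma isSES_ind (hN : IsNilpotentBimodule R M N) (X : ModuleCat.{u} R) :
    IsSES (ind R M N X).str (indTop X) where
  inj := by
    rw [injective_iff_map_eq_zero]
    intro x hx
    have h : ∀ i : Fin (N + 1), ((𝔽).map (indProj X i)).hom x = 0 := by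
      intro i
      induction i using Fin.lastCases with
      -- The structure map forgets M ⊗ (summand N), which is harmless because that module is zero by
      -- nilpotence.
      | last =>
        have : Subsingleton ((𝔽).obj (tensorPow R M X N)) := subsingleton_tensorPow hN X
        exact Subsingleton.elim (α := (𝔽).obj (tensorPow R M X N)) _ _
      | cast i =>
        rw [← ind_str_proj_succ]
        change (indProj X i.succ).hom ((ind R M N X).str.hom x) = 0
        rw [hx, map_zero]
    have h2 : ((𝔽).map (𝟙 (ind R M N X).a)).hom x = 0 := by
      rw [← sum_indProj_indIncl, (𝔽).map_sum, ModuleCat.hom_sum, LinearMap.sum_apply]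
      refine Finset.sum_eq_zero fun i _ => ?_
      rw [(𝔽).map_comp]
      change ((𝔽).map (indIncl X i)).hom (((𝔽).map (indProj X i)).hom x) = 0
      rw [h, map_zero]
    rwa [(𝔽).map_id] at h2
  exact y := by
    constructor
    · intro hy
      refine ⟨∑ i : Fin N, ((𝔽).map (indIncl X i.castSucc)).hom ((indProj X i.succ).hom y),
        ind_ext fun j => ?_⟩
      rw [map_sum, map_sum]
      refine (Finset.sum_congr rfl fun i _ => congrArg (indProj X j).hom
        (hom_hom_of_comp_eq (indIncl_succ (R := R) (M := M) (X := X) i).symm _)).trans ?_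
      have hne : ∀ i : Fin N, i.succ ≠ j → (indProj X j).hom ((indIncl X i.succ).hom
          ((indProj X i.succ).hom y)) = 0 := fun i hi =>
        hom_hom_of_comp_eq_zero (indIncl_indProj_ne hi.symm) _
      have hself : (indProj X j).hom ((indIncl X j).hom ((indProj X j).hom y)) =
          (indProj X j).hom y := hom_hom_of_comp_eq (indIncl_indProj_self j) _
      induction j using Fin.cases with
      | zero => exact (Finset.sum_eq_zero fun i _ => hne i (Fin.succ_ne_zero i)).trans hy.symm
      | succ j =>
        refine (Finset.sum_eq_single j (fun i _ hi => hne i (by simpa using hi))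
          (by simp)).trans hself
    · rintro ⟨x, rfl⟩
      exact hom_hom_of_comp_eq_zero ind_str_proj_zero x
  surj x := ⟨(indUnit X).hom x, hom_hom_of_comp_eq indUnit_indTop x⟩

/-- The components of the morphism `Ind(X) ⟶ A` induced by `X ⟶ A`. -/
def indDescComponent (φ : X ⟶ A.a) : ∀ k : ℕ, tensorPow R M X k ⟶ A.a
  | 0 => φ
  | k + 1 => (𝔽).map (indDescComponent φ k) ≫ A.str

lemma exists_ind_desc (hN : IsNilpotentBimodule R M N) (φ : X ⟶ A.a) :
    ∃ Φ : ind R M N X ⟶ A, indUnit X ≫ Φ.f = φ := by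
  refine ⟨⟨∑ i : Fin (N + 1), indProj X i ≫ indDescComponent φ i, ?_⟩, ?_⟩
  · rw [(𝔽).map_sum, Preadditive.sum_comp, Preadditive.comp_sum, Fin.sum_univ_castSucc,
      Fin.sum_univ_succ, ← Category.assoc _ (indProj X 0), ind_str_proj_zero, Limits.zero_comp,
      zero_add]
    -- After reindexing by one, the only unmatched term passes through M^(N+1) ⊗ X = 0.
    have hz : (𝔽).map (indProj X (Fin.last N) ≫ indDescComponent φ (Fin.last N)) ≫ A.str = 0 := by
      have : Subsingleton ((𝔽).obj (tensorPow R M X (Fin.last N))) := subsingleton_tensorPow hN X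
      rw [(𝔽).map_comp, modHom_eq_of_subsingleton this
        ((𝔽).map (indProj X (Fin.last N))) 0, Limits.zero_comp, Limits.zero_comp]
    rw [hz, add_zero]
    refine Finset.sum_congr rfl fun i _ => ?_
    rw [← Category.assoc, ind_str_proj_succ, (𝔽).map_comp, Category.assoc]
    rfl
  · change indIncl X 0 ≫ _ = φ
    rw [Preadditive.comp_sum, Finset.sum_eq_single 0]
    · rw [← Category.assoc, indIncl_indProj_self, Category.id_comp]
      rfl
    · intro i _ hi
      rw [← Category.assoc, indIncl_indProj_ne hi, Limits.zero_comp]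
    · simp

/-- A compatible family of maps `A ⟶ M^{⊗ k} ⊗ X` defines a morphism `(A, u) ⟶ Ind(X)`. -/
def indLift (φ : ∀ k : ℕ, A.a ⟶ tensorPow R M X k) (h0 : A.str ≫ φ 0 = 0)
    (h : ∀ k, A.str ≫ φ (k + 1) = (𝔽).map (φ k)) : A ⟶ ind R M N X where
  f := ModuleCat.ofHom (LinearMap.pi fun i : Fin (N + 1) => (φ i).hom)
  h := by
    let g : A.a ⟶ (ind R M N X).a :=
      ModuleCat.ofHom (LinearMap.pi fun i : Fin (N + 1) => (φ i).hom)
    refine ind_hom_ext fun i => ?_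
    change ((𝔽).map g ≫ (ind R M N X).str) ≫ indProj X i = (A.str ≫ g) ≫ indProj X i
    rw [Category.assoc, Category.assoc]
    induction i using Fin.cases with
    | zero => rw [ind_str_proj_zero, Limits.comp_zero]; exact h0.symm
    | succ i =>
      rw [ind_str_proj_succ]
      exact ((𝔽).map_comp g (indProj X i.castSucc)).symm.trans (h i).symm

/-- Converse to `indLift`. Components beyond N are set to zero; the compatibility there is automatic
since M^(k+1) ⊗ X = 0 for k ≥ N. -/
lemma exists_components (hN : IsNilpotentBimodule R M N) (f : A ⟶ ind R M N X) :
    ∃ φ : ∀ k : ℕ, A.a ⟶ tensorPow R M X k, A.str ≫ φ 0 = 0 ∧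
      (∀ k, A.str ≫ φ (k + 1) = (𝔽).map (φ k)) ∧ ∀ i : Fin (N + 1), f.f ≫ indProj X i = φ i := by
  let φ : ∀ k : ℕ, A.a ⟶ tensorPow R M X k := fun k =>
    if hk : k < N + 1 then f.f ≫ indProj X ⟨k, hk⟩ else 0
  have hφ : ∀ k (hk : k < N + 1), φ k = f.f ≫ indProj X ⟨k, hk⟩ := fun k hk => dif_pos hk
  refine ⟨φ, ?_, fun k => ?_, fun i => (hφ i i.2).symm⟩
  · rw [hφ 0 (Nat.succ_pos N), ← Category.assoc, ← f.h, Category.assoc]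
    exact Limits.comp_zero
  · by_cases hk : k < N
    · have h1 : A.str ≫ φ (k + 1) = (𝔽).map f.f ≫ (ind R M N X).str ≫
          indProj X ⟨k + 1, Nat.succ_lt_succ hk⟩ := by
        rw [hφ (k + 1) (Nat.succ_lt_succ hk), ← Category.assoc, ← f.h, Category.assoc]
      have h2 : (𝔽).map (φ k) =
          (𝔽).map f.f ≫ (𝔽).map (indProj X ⟨k, hk.trans (Nat.lt_succ_self N)⟩) := by
        rw [hφ k (hk.trans (Nat.lt_succ_self N)), (𝔽).map_comp]
      exact h1.trans h2.symm
    · exact modHom_eq_of_subsingleton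
        (subsingleton_tensorPow_of_le (X := X) hN (Nat.succ_le_succ (Nat.le_of_not_lt hk))) _ _

lemma projective_ind (hN : IsNilpotentBimodule R M N) {P : ModuleCat.{u} R} (hP : Projective P) :
    Projective (ind R M N P) where
  factors {A B} f e _ := by
    have he : Epi e.f := (ModuleCat.epi_iff_surjective _).2 (surjective_of_tmod_epi e)
    obtain ⟨Φ, hΦ⟩ := exists_ind_desc hN (Projective.factorThru (indUnit P ≫ f.f) e.f)
    refine ⟨Φ, ind_hom_eq_of_unit ?_⟩
    change indUnit P ≫ Φ.f ≫ e.f = _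
    rw [← Category.assoc, hΦ, Projective.factorThru_comp]

lemma nonempty_iso_coker_ind (hN : IsNilpotentBimodule R M N) (X : ModuleCat.{u} R) :
    Nonempty ((cokerFunctor R M).obj (ind R M N X) ≅ X) := by
  have hS := isSES_ind hN X
  obtain ⟨ψ, hψ⟩ := exists_desc (cokerπ (ind R M N X)) (cokerπ_surjective _) (indTop X)
    fun x hx => (hS.exact x).2 ((cokerπ_exact _ x).1 hx)
  have : IsIso ψ := by
    rw [ConcreteCategory.isIso_iff_bijective]
    constructor
    · refine (injective_iff_map_eq_zero ψ.hom).2 fun x hx => ?_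
      obtain ⟨x, rfl⟩ := cokerπ_surjective _ x
      rw [hom_hom_of_comp_eq hψ] at hx
      exact (cokerπ_exact _ x).2 ((hS.exact x).1 hx)
    · intro x
      obtain ⟨y, rfl⟩ := hS.surj x
      exact ⟨_, hom_hom_of_comp_eq hψ y⟩
  exact ⟨asIso ψ⟩

lemma tmod_exists_surjection (hN : IsNilpotentBimodule R M N) (A : TMod R M) :
    ∃ (P : ModuleCat.{u} R) (p : ind R M N P ⟶ A), Projective P ∧ Surjective p.f.hom := by
  obtain ⟨p, hp⟩ := exists_ind_desc hN (Projective.π A.a)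
  refine ⟨_, p, inferInstance, ?_⟩
  have h : Surjective (Projective.π A.a).hom := (ModuleCat.epi_iff_surjective _).1 inferInstance
  rw [← hp] at h
  exact Surjective.of_comp (g := (indUnit _).hom) h

/-- A is a retract of some Ind(P), whose structure map is injective by `isSES_ind`. -/
lemma str_injective_of_projective (hN : IsNilpotentBimodule R M N) (hA : Projective A) :
    Injective A.str.hom := by
  obtain ⟨P, p, _, hp⟩ := tmod_exists_surjection hN A
  have := tmod_epi_of_surjective p hp
  obtain ⟨s, hs⟩ : ∃ s : A ⟶ ind R M N P, s ≫ p = 𝟙 A := ⟨_, Projective.factorThru_comp (𝟙 A) p⟩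
  have hsf : s.f ≫ p.f = 𝟙 A.a := congrArg Endofunctor.Algebra.Hom.f hs
  have hFs : (𝔽).map s.f ≫ (𝔽).map p.f = 𝟙 _ := by
    rw [← (𝔽).map_comp, hsf, (𝔽).map_id]
  refine (injective_iff_map_eq_zero A.str.hom).2 fun x hx => ?_
  have h1 : (ind R M N P).str.hom (((𝔽).map s.f).hom x) = (ind R M N P).str.hom 0 := by
    rw [← hom_str, hx, map_zero, map_zero]
  have h2 := hom_hom_of_comp_eq hFs x
  rw [(isSES_ind hN P).inj h1, map_zero] at h2
  exact h2.symm

lemma projective_coker (hN : IsNilpotentBimodule R M N) (hA : Projective A) :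
    Projective ((cokerFunctor R M).obj A) := by
  obtain ⟨P, p, hP, hp⟩ := tmod_exists_surjection hN A
  have := tmod_epi_of_surjective p hp
  obtain ⟨e⟩ := nonempty_iso_coker_ind (M := M) hN P
  have hQ : Projective ((cokerFunctor R M).obj (ind R M N P)) := Projective.of_iso e.symm hP
  have hs : Projective.factorThru (𝟙 A) p ≫ p = 𝟙 A := Projective.factorThru_comp _ _
  exact Retract.projective ⟨(cokerFunctor R M).map (Projective.factorThru (𝟙 A) p),
    (cokerFunctor R M).map p, by rw [← Functor.map_comp, hs, CategoryTheory.Functor.map_id]⟩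

end Ind

end TMod

/-! ### Exactness criteria with free indices. -/

section Complex

variable {R : Type u} [Ring R]

lemma isExactComplex_iff (P : CochainComplex (ModuleCat.{u} R) ℤ) :
    IsExactComplex P ↔
      ∀ i j k : ℤ, i + 1 = j → j + 1 = k → Exact (P.d i j).hom (P.d j k).hom := by
  constructor
  · rintro h i j k hij rfl
    obtain rfl : i = j - 1 := by lia
    exact h j
  · exact fun h n => h _ _ _ (by lia) rfl

lemma isHomExact_iff {C : Type*} [Category C] [Preadditive C] (P : CochainComplex C ℤ) (X : C) :
    IsHomExact P X ↔ ∀ i j k : ℤ, i + 1 = j → j + 1 = k → ∀ f : P.X j ⟶ X,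
      P.d i j ≫ f = 0 → ∃ g : P.X k ⟶ X, P.d j k ≫ g = f := by
  constructor
  · rintro h i j k hij rfl f hf
    obtain rfl : i = j - 1 := by lia
    exact (h j f).1 hf
  · intro h n f
    refine ⟨h _ _ _ (by lia) rfl f, ?_⟩
    rintro ⟨g, rfl⟩
    change P.d (n - 1) n ≫ P.d n (n + 1) ≫ g = 0
    rw [← Category.assoc, P.d_comp_d, Limits.zero_comp]

end Complex

/-! ### From complete resolutions over the tensor ring to their cokernels. -/

section TMod

variable {R : Type u} [Ring R] {M : Type u} [AddCommGroup M] [Module R M] [Module Rᵐᵒᵖ M]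
variable {N : ℕ} {𝒳 : ObjectProperty (ModuleCat.{u} R)}

local notation "𝔽" => tensorFunctor R M

/-- `M^{⊗ k} ⊗ (M ⊗ X) ≅ M^{⊗ (k + 1)} ⊗ X`. -/
def shiftIso (M : Type u) [AddCommGroup M] [Module R M] [Module Rᵐᵒᵖ M] (X : ModuleCat.{u} R) :
    ∀ k : ℕ, tensorPow R M ((tensorFunctor R M).obj X) k ≅ tensorPow R M X (k + 1)
  | 0 => Iso.refl _
  | k + 1 => (tensorFunctor R M).mapIso (shiftIso M X k)

/-- Shifting the summands by one identifies Ind(M ⊗ X) with the part of Ind(X) in positive degrees;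
its own top summand is M^(N+1) ⊗ X = 0. -/
lemma exists_ind_shift (hN : IsNilpotentBimodule R M N) (X : ModuleCat.{u} R) :
    ∃ ι : ind R M N ((𝔽).obj X) ⟶ ind R M N X, IsSES ι.f (indTop X) := by
  obtain ⟨ψ, h0, hs, hψ⟩ := exists_components hN (𝟙 (ind R M N ((𝔽).obj X)))
  let φ : ∀ k : ℕ, (ind R M N ((𝔽).obj X)).a ⟶ tensorPow R M X k
    | 0 => 0
    | k + 1 => ψ k ≫ (shiftIso M X k).hom
  have hφ0 : (ind R M N ((𝔽).obj X)).str ≫ φ 0 = 0 := Limits.comp_zero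
  have hφ : ∀ k, (ind R M N ((𝔽).obj X)).str ≫ φ (k + 1) = (𝔽).map (φ k) := by
    rintro (_ | k)
    · have h1 : ((ind R M N ((𝔽).obj X)).str ≫ ψ 0) ≫ (shiftIso M X 0).hom = 0 := by
        rw [h0, Limits.zero_comp]
      exact (Category.assoc _ _ _).symm.trans (h1.trans ((𝔽).map_zero _ _).symm)
    · exact (Category.assoc _ _ _).symm.trans
        ((congrArg (· ≫ (shiftIso M X (k + 1)).hom) (hs k)).trans
          ((𝔽).map_comp (ψ k) (shiftIso M X k).hom).symm)
  have hψ' : ∀ i : Fin (N + 1), indProj ((𝔽).obj X) i = ψ i := fun i =>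
    (Category.id_comp _).symm.trans (hψ i)
  have hsucc : ∀ (i : Fin N) y, (indProj X i.succ).hom ((indLift (N := N) φ hφ0 hφ).f.hom y) =
      (shiftIso M X i).hom.hom ((indProj ((𝔽).obj X) i.castSucc).hom y) := fun i y =>
    congrArg (fun t : (ind R M N ((𝔽).obj X)).a ⟶ tensorPow R M ((𝔽).obj X) i =>
      (shiftIso M X i).hom.hom (t.hom y)) (hψ' i.castSucc).symm
  have hinj : ∀ k, Injective (shiftIso M X k).hom.hom := fun k =>
    (ModuleCat.mono_iff_injective _).1 inferInstance
  refine ⟨indLift (N := N) φ hφ0 hφ, ?_, fun x => ⟨fun hx => ?_, ?_⟩, (isSES_ind hN X).surj⟩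
  · refine (injective_iff_map_eq_zero (indLift (N := N) φ hφ0 hφ).f.hom).2 fun y hy => ?_
    refine ind_ext fun i => ?_
    rw [map_zero]
    induction i using Fin.lastCases with
    | last =>
      have := subsingleton_tensorPow hN X
      exact hinj N (Subsingleton.elim (α := tensorPow R M X (N + 1)) _ _)
    | cast i =>
      refine hinj i ?_
      have := hsucc i y
      rw [hy, map_zero] at this
      exact this.symm.trans (map_zero _).symm
  · let y : (ind R M N ((𝔽).obj X)).a := fun i =>
      if h : (i : ℕ) + 1 < N + 1 then
        (shiftIso M X i).inv.hom ((indProj X ⟨(i : ℕ) + 1, h⟩).hom x) else 0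
    have hy : ∀ i : Fin N, (indProj ((𝔽).obj X) i.castSucc).hom y =
        (shiftIso M X i).inv.hom ((indProj X i.succ).hom x) := fun i =>
      dif_pos (Nat.succ_lt_succ i.2)
    refine ⟨y, ind_ext fun i => ?_⟩
    induction i using Fin.cases with
    | zero => exact hx.symm
    | succ i =>
      rw [hsucc, hy]
      exact hom_hom_of_comp_eq (shiftIso M X i).inv_hom_id _
  · rintro ⟨y, rfl⟩
    rfl

variable {Q : CochainComplex (TMod R M) ℤ}

lemma tmod_exact (h : IsExactComplex (((forgetT R M).mapHomologicalComplex _).obj Q))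
    {i j k : ℤ} (hij : i + 1 = j) (hjk : j + 1 = k) : Exact (Q.d i j).f.hom (Q.d j k).f.hom :=
  (isExactComplex_iff _).1 h i j k hij hjk

lemma tmod_tensor_exact
    (h : IsExactComplex (((forgetT R M ⋙ 𝔽).mapHomologicalComplex _).obj Q))
    {i j k : ℤ} (hij : i + 1 = j) (hjk : j + 1 = k) :
    Exact ((𝔽).map (Q.d i j).f).hom ((𝔽).map (Q.d j k).f).hom :=
  (isExactComplex_iff _).1 h i j k hij hjk

/-- If d x = u y, then injectivity of the next structure map makes y a cycle of M ⊗ Q, hence a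
boundary (M ⊗ d) z, and x - u z is a cycle. This is the connecting step of the long exact sequence.
-/
lemma exists_of_hom_mem_range_str (hN : IsNilpotentBimodule R M N)
    (hproj : ∀ n, Projective (Q.X n))
    (hF : IsExactComplex (((forgetT R M ⋙ 𝔽).mapHomologicalComplex _).obj Q))
    {j k : ℤ} (hjk : j + 1 = k) {x : (Q.X j).a}
    {y : (𝔽).obj (Q.X k).a} (hy : (Q.X k).str.hom y = (Q.d j k).f.hom x) :
    ∃ z : (𝔽).obj (Q.X j).a, (Q.d j k).f.hom (x - (Q.X j).str.hom z) = 0 := by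
  have h1 : ((𝔽).map (Q.d k (k + 1)).f).hom y = 0 := by
    apply str_injective_of_projective hN (hproj (k + 1))
    rw [← hom_str, hy, map_zero, tmod_comp_apply (Q.d_comp_d j k (k + 1))]
    rfl
  obtain ⟨z, rfl⟩ := (tmod_tensor_exact hF hjk rfl y).1 h1
  exact ⟨z, by rw [map_sub, hom_str, hy, sub_self]⟩

lemma coker_complex_exact (hN : IsNilpotentBimodule R M N) (hproj : ∀ n, Projective (Q.X n))
    (hQ : IsExactComplex (((forgetT R M).mapHomologicalComplex _).obj Q))
    (hF : IsExactComplex (((forgetT R M ⋙ 𝔽).mapHomologicalComplex _).obj Q)) :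
    IsExactComplex (((cokerFunctor R M).mapHomologicalComplex _).obj Q) := by
  rw [isExactComplex_iff]
  intro i j k hij hjk x
  change ((cokerFunctor R M).map (Q.d j k)).hom x = 0 ↔
    x ∈ Set.range ((cokerFunctor R M).map (Q.d i j)).hom
  constructor
  · intro hx
    obtain ⟨x, rfl⟩ := cokerπ_surjective _ x
    rw [hom_hom_of_square (cokerπ_naturality _)] at hx
    obtain ⟨y, hy⟩ := (cokerπ_exact _ _).1 hx
    obtain ⟨z, hz⟩ := exists_of_hom_mem_range_str hN hproj hF hjk hy
    obtain ⟨w, hw⟩ := (tmod_exact hQ hij hjk _).1 hz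
    refine ⟨(cokerπ _).hom w, ?_⟩
    rw [hom_hom_of_square (cokerπ_naturality _), hw, map_sub,
      hom_hom_of_comp_eq_zero (str_comp_cokerπ _), sub_zero]
  · rintro ⟨w, rfl⟩
    refine hom_hom_of_comp_eq_zero ?_ w
    rw [← (cokerFunctor R M).map_comp, Q.d_comp_d, (cokerFunctor R M).map_zero]

lemma coker_complex_homExact (hN : IsNilpotentBimodule R M N) (hproj : ∀ n, Projective (Q.X n))
    {X : ModuleCat.{u} R} (h₁ : IsHomExact Q (ind R M N X))
    (h₂ : IsHomExact Q (ind R M N ((𝔽).obj X))) :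
    IsHomExact (((cokerFunctor R M).mapHomologicalComplex _).obj Q) X := by
  rw [isHomExact_iff] at h₁ h₂ ⊢
  intro i j k hij hjk
  change ∀ f : (cokerFunctor R M).obj (Q.X j) ⟶ X, (cokerFunctor R M).map (Q.d i j) ≫ f = 0 →
    ∃ g : (cokerFunctor R M).obj (Q.X k) ⟶ X, (cokerFunctor R M).map (Q.d j k) ≫ g = f
  intro f hf
  obtain ⟨ι, hι⟩ := exists_ind_shift hN X
  let SX : TMod R M := ⟨X, 0⟩
  let top : ind R M N X ⟶ SX := ⟨indTop X, Limits.comp_zero⟩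
  let g : Q.X j ⟶ SX := ⟨cokerπ _ ≫ f, by
    rw [← Category.assoc, str_comp_cokerπ, Limits.zero_comp]
    exact Limits.comp_zero⟩
  have : Epi top := tmod_epi_of_surjective top hι.surj
  have := hproj j
  let l : Q.X j ⟶ ind R M N X := Projective.factorThru g top
  have hl : l.f ≫ indTop X = cokerπ _ ≫ f :=
    congrArg Endofunctor.Algebra.Hom.f (Projective.factorThru_comp g top)
  obtain ⟨h, hh⟩ := tmod_exists_lift ι hι.inj (Q.d i j ≫ l) fun x => by
    rw [← Set.mem_range, ← hι.exact]
    change (indTop X).hom (l.f.hom ((Q.d i j).f.hom x)) = 0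
    rw [hom_hom_of_comp_eq hl]
    change f.hom ((cokerπ _).hom ((Q.d i j).f.hom x)) = 0
    rw [← hom_hom_of_square (cokerπ_naturality (Q.d i j)), hom_hom_of_comp_eq_zero hf]
  -- The lift l need not be a cocycle; its coboundary h takes values in Ind(M ⊗ X). Being a cocycle
  -- there, h equals d ≫ r, and l - r ≫ ι is a cocycle lifting the same map.
  have hdh : Q.d (i - 1) i ≫ h = 0 := tmod_hom_ext fun x => hι.inj <| by
    change ι.f.hom (h.f.hom ((Q.d (i - 1) i).f.hom x)) = ι.f.hom 0
    rw [tmod_comp_apply hh, map_zero]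
    change l.f.hom ((Q.d i j).f.hom ((Q.d (i - 1) i).f.hom x)) = 0
    rw [tmod_comp_apply (Q.d_comp_d (i - 1) i j)]
    exact map_zero l.f.hom
  obtain ⟨r, hr⟩ := h₂ (i - 1) i j (by lia) hij h hdh
  obtain ⟨m, hm⟩ := h₁ i j k hij hjk (l - r ≫ ι) (by
    rw [Preadditive.comp_sub, ← Category.assoc, hr, hh, sub_self])
  obtain ⟨s, hs⟩ := exists_desc (cokerπ (Q.X k)) (cokerπ_surjective _) (m.f ≫ indTop X)
    fun x hx => by
      obtain ⟨z, rfl⟩ := (cokerπ_exact _ _).1 hx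
      change (indTop X).hom (m.f.hom _) = 0
      rw [hom_str]
      exact (isSES_ind hN X).exact.apply_apply_eq_zero _
  refine ⟨s, modHom_ext fun x => ?_⟩
  obtain ⟨x, rfl⟩ := cokerπ_surjective _ x
  change s.hom (((cokerFunctor R M).map (Q.d j k)).hom _) = _
  rw [hom_hom_of_square (cokerπ_naturality (Q.d j k)), hom_hom_of_comp_eq hs]
  change (indTop X).hom (m.f.hom ((Q.d j k).f.hom x)) = f.hom ((cokerπ (Q.X j)).hom x)
  rw [tmod_comp_apply hm]
  change (indTop X).hom (l.f.hom x - ι.f.hom (r.f.hom x)) = _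
  rw [map_sub, hι.exact.apply_apply_eq_zero, sub_zero, hom_hom_of_comp_eq hl]
  rfl

/-- If u y = 0, a lift of y to M ⊗ Q⁻¹ is a cycle, since the structure map of Q⁰ is injective; so it
is a boundary and y = 0. The coker of Q then resolves coker u. -/
lemma phi_of_gorensteinProj (hN : IsNilpotentBimodule R M N) (hcomp : IsCompatible M N 𝒳)
    {A : TMod R M} (hA : GPT M (indClass R M N 𝒳) A) : Phi M (GP 𝒳) A := by
  obtain ⟨Q, hQ, p, j, hp, hj, hpj⟩ := hA
  replace hp : Surjective p.f.hom := hp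
  replace hj : Injective j.f.hom := hj
  obtain ⟨hF, hH⟩ := hcomp Q hQ
  have hproj := hQ.projective
  have hdp : Q.d (-2) (-1) ≫ p = 0 := tmod_hom_ext fun x => hj <| by
    change j.f.hom (p.f.hom ((Q.d (-2) (-1)).f.hom x)) = j.f.hom 0
    rw [tmod_comp_apply hpj, tmod_comp_apply (Q.d_comp_d _ _ _), map_zero]
    rfl
  refine ⟨?_, ?_⟩
  · refine (injective_iff_map_eq_zero A.str.hom).2 fun y hy => ?_
    obtain ⟨z, rfl⟩ := tensor_surjective R M hp y
    have hz : ((𝔽).map (Q.d (-1) 0).f).hom z = 0 := by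
      apply str_injective_of_projective hN (hproj 0)
      rw [← hom_str, map_zero, ← tmod_comp_apply hpj, hom_str p]
      exact (congrArg j.f.hom hy).trans (map_zero _)
    obtain ⟨w, rfl⟩ := (tmod_tensor_exact hF (by norm_num : (-2 : ℤ) + 1 = -1) (by norm_num) z).1 hz
    refine hom_hom_of_comp_eq_zero ?_ w
    rw [← (𝔽).map_comp]
    exact (congrArg (fun t => (𝔽).map (Endofunctor.Algebra.Hom.f t)) hdp).trans ((𝔽).map_zero _ _)
  · refine ⟨((cokerFunctor R M).mapHomologicalComplex _).obj Q,
      ⟨fun n => projective_coker hN (hproj n), coker_complex_exact hN hproj hQ.exact hF,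
        fun X hX => coker_complex_homExact hN hproj (hQ.hom_exact _ ⟨X, hX, rfl⟩) (hH X hX)⟩,
      (cokerFunctor R M).map p, (cokerFunctor R M).map j, ?_, ?_, ?_⟩
    · intro x
      obtain ⟨x, rfl⟩ := cokerπ_surjective A x
      obtain ⟨y, rfl⟩ := hp x
      exact ⟨(cokerπ _).hom y, rfl⟩
    · refine (injective_iff_map_eq_zero ((cokerFunctor R M).map j).hom).2 fun x hx => ?_
      obtain ⟨x, rfl⟩ := cokerπ_surjective A x
      obtain ⟨w, rfl⟩ := hp x
      rw [hom_hom_of_square (cokerπ_naturality _)] at hx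
      obtain ⟨y, hy⟩ := (cokerπ_exact _ _).1 hx
      have hy' : (Q.X 0).str.hom y = (Q.d (-1) 0).f.hom w := hy.trans (tmod_comp_apply hpj w)
      obtain ⟨z, hz⟩ := exists_of_hom_mem_range_str hN hproj hF (by norm_num) hy'
      refine (cokerπ_exact _ _).2 ⟨((𝔽).map p.f).hom z, hj ?_⟩
      rw [map_sub, sub_eq_zero] at hz
      rw [← hom_str p]
      exact (tmod_comp_apply hpj _).trans (hz.symm.trans (tmod_comp_apply hpj w).symm)
    · exact ((cokerFunctor R M).map_comp p j).symm.trans (congrArg (cokerFunctor R M).map hpj)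

end TMod

/-! ### Syzygies and cosyzygies of Gorenstein projective R-modules. -/

section Module

variable {R : Type u} [Ring R] {𝒳 : ObjectProperty (ModuleCat.{u} R)}

/-- The syzygies of a complete projective resolution are Gorenstein projective. -/
lemma gp_of_factorization {P : CochainComplex (ModuleCat.{u} R) ℤ}
    (hP : IsCompleteProjRes (𝟭 _) 𝒳 P) (a i j : ℤ) (hi : i = -1 + a) (hj : j = 0 + a)
    {G : ModuleCat.{u} R} (p : P.X i ⟶ G) (q : G ⟶ P.X j) (hp : Surjective p.hom)
    (hq : Injective q.hom) (hpq : p ≫ q = P.d i j) : GP 𝒳 G := by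
  -- Now P.X i and P.X j are literally degrees -1 and 0 of the shifted complex, so p and q need no
  -- transport.
  subst hi hj
  let P' : CochainComplex (ModuleCat.{u} R) ℤ :=
    { X := fun n => P.X (n + a)
      d := fun m n => P.d (m + a) (n + a)
      shape := fun m n h => P.shape _ _ fun h' => h (by
        change m + a + 1 = n + a at h'
        change m + 1 = n
        lia)
      d_comp_d' := fun _ _ _ _ _ => P.d_comp_d _ _ _ }
  refine ⟨P', ⟨fun n => hP.projective _, ?_, fun X hX => ?_⟩, p, q, hp, hq, hpq⟩
  · rw [isExactComplex_iff]
    intro i j k hij hjk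
    exact (isExactComplex_iff _).1 hP.exact (i + a) (j + a) (k + a) (by lia) (by lia)
  · rw [isHomExact_iff]
    intro i j k hij hjk
    exact (isHomExact_iff _ _).1 (hP.hom_exact X hX) (i + a) (j + a) (k + a) (by lia) (by lia)

lemma gp_range {P : CochainComplex (ModuleCat.{u} R) ℤ}
    (hP : IsCompleteProjRes (𝟭 _) 𝒳 P) (i j : ℤ) (hij : i + 1 = j) :
    GP 𝒳 (ModuleCat.of R (LinearMap.range (P.d i j).hom)) :=
  gp_of_factorization hP j i j (by lia) (by lia) (ModuleCat.ofHom (P.d i j).hom.rangeRestrict)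
    (ModuleCat.ofHom (LinearMap.range (P.d i j).hom).subtype)
    (P.d i j).hom.surjective_rangeRestrict Subtype.val_injective rfl

lemma GP.exists_coresolution {G : ModuleCat.{u} R} (hG : GP 𝒳 G) :
    ∃ (P G' : ModuleCat.{u} R) (f : G ⟶ P) (g : P ⟶ G'), Projective P ∧ GP 𝒳 G' ∧ IsSES f g := by
  obtain ⟨P, hP, p, q, hp, hq, hpq⟩ := hG
  replace hp : Surjective p.hom := hp
  replace hq : Injective q.hom := hq
  refine ⟨P.X 0, _, q, ModuleCat.ofHom (P.d 0 1).hom.rangeRestrict, hP.projective 0,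
    gp_range hP 0 1 rfl, hq, fun x => ?_, (P.d 0 1).hom.surjective_rangeRestrict⟩
  have hex : Exact (P.d (-1) 0).hom (P.d 0 1).hom :=
    (isExactComplex_iff _).1 hP.exact (-1) 0 1 (by norm_num) (by norm_num)
  refine Subtype.ext_iff.trans ((hex x).trans ⟨?_, ?_⟩)
  · rintro ⟨y, rfl⟩
    exact ⟨p.hom y, hom_hom_of_comp_eq hpq y⟩
  · rintro ⟨y, rfl⟩
    obtain ⟨z, rfl⟩ := hp y
    exact ⟨z, (hom_hom_of_comp_eq hpq z).symm⟩

lemma GP.exists_resolution {G : ModuleCat.{u} R} (hG : GP 𝒳 G) :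
    ∃ (G' P : ModuleCat.{u} R) (f : G' ⟶ P) (g : P ⟶ G), Projective P ∧ GP 𝒳 G' ∧ IsSES f g := by
  obtain ⟨P, hP, p, q, hp, hq, hpq⟩ := hG
  replace hp : Surjective p.hom := hp
  replace hq : Injective q.hom := hq
  refine ⟨_, P.X (-1), ModuleCat.ofHom (LinearMap.range (P.d (-2) (-1)).hom).subtype, p,
    hP.projective _, gp_range hP (-2) (-1) (by norm_num), Subtype.val_injective, fun x => ?_, hp⟩
  have hex : Exact (P.d (-2) (-1)).hom (P.d (-1) 0).hom :=
    (isExactComplex_iff _).1 hP.exact (-2) (-1) 0 (by norm_num) (by norm_num)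
  have h1 : p.hom x = 0 ↔ (P.d (-1) 0).hom x = 0 := by
    rw [← hpq]
    exact (map_eq_zero_iff q.hom hq).symm
  rw [h1, hex x]
  exact ⟨fun ⟨y, hy⟩ => ⟨⟨x, y, hy⟩, rfl⟩, fun ⟨⟨_, y, hy⟩, e⟩ => ⟨y, hy.trans e⟩⟩

lemma exists_dependent_seq {S : ℕ → Type*} (s₀ : S 0) (r : ∀ k, S k → S (k + 1) → Prop)
    (h : ∀ k s, ∃ s', r k s s') : ∃ s : ∀ k, S k, s 0 = s₀ ∧ ∀ k, r k (s k) (s (k + 1)) := by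
  choose next hnext using h
  exact ⟨fun k => Nat.rec s₀ next k, rfl, fun k => hnext k _⟩

lemma of_descending {p : ℕ → Prop} (n : ℕ) (hn : p n) (h : ∀ k, p (k + 1) → p k) : p 0 := by
  induction n with
  | zero => exact hn
  | succ n ih => exact ih (h n hn)

end Module

/-! ### From Gorenstein projective cokernels to complete resolutions. -/

section TMod

variable {R : Type u} [Ring R] {M : Type u} [AddCommGroup M] [Module R M] [Module Rᵐᵒᵖ M]
variable {N : ℕ} {𝒳 : ObjectProperty (ModuleCat.{u} R)}

local notation "𝔽" => tensorFunctor R M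

/-- `Tor₁(M, M^{⊗ k} ⊗ G)` vanishes for all `k`, in terms of short exact sequences. -/
def PowPreserves (M : Type u) [AddCommGroup M] [Module R M] [Module Rᵐᵒᵖ M]
    (G : ModuleCat.{u} R) : Prop :=
  ∀ k, TensorPreserves R M ((powFunctor R M k).obj G)

lemma IsAdmissible.powPreserves (hadm : IsAdmissible M 𝒳)
    (h𝒳 : ∀ P : ModuleCat.{u} R, Projective P → 𝒳 P) {G : ModuleCat.{u} R} (hG : GP 𝒳 G) :
    PowPreserves M G := by
  intro k
  rw [powFunctor_obj]
  -- The Tor condition does not involve X; any projective serves as the required member of 𝒳.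
  exact tensorPreserves_of_subsingleton R M
    (hadm G hG _ (h𝒳 (Projective.over G) inferInstance) k).2

lemma PowPreserves.isSES {A B G : ModuleCat.{u} R} {f : A ⟶ B} {g : B ⟶ G}
    (hG : PowPreserves M G) (h : IsSES f g) (k : ℕ) :
    IsSES ((powFunctor R M k).map f) ((powFunctor R M k).map g) := by
  induction k with
  | zero => exact h
  | succ k ih => exact isSES_tensor M ih (hG k)

lemma PowPreserves.extension {A B G : ModuleCat.{u} R} {f : A ⟶ B} {g : B ⟶ G}
    (hA : PowPreserves M A) (hG : PowPreserves M G) (h : IsSES f g) : PowPreserves M B :=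
  fun k => tensorPreserves_extension M (hG.isSES h k) (hA k) (hG k)

variable {A B C : TMod R M} {G G' G'' : ModuleCat.{u} R}

/-- M^k ⊗ A is an extension of M^k ⊗ G by M^(k+1) ⊗ A, so the property descends from k = N + 1 to k
= 0. -/
lemma tensorPreserves_of_isSES (hN : IsNilpotentBimodule R M N) {π : A.a ⟶ G}
    (hA : IsSES A.str π) (hG : PowPreserves M G) : TensorPreserves R M A.a := by
  refine of_descending (p := fun k => TensorPreserves R M ((powFunctor R M k).obj A.a)) (N + 1)
    (tensorPreserves_of_subsingleton_obj M (subsingleton_powFunctor hN A.a)) fun k hk => ?_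
  refine tensorPreserves_extension M (hG.isSES hA k) ?_ (hG k)
  rw [powFunctor_succ'] at hk
  exact hk

/-- A Nakayama argument: the cokernel D of e has surjective structure map, so vanishing of M^(k+1) ⊗
D forces that of M^k ⊗ D. -/
lemma surjective_of_surjective_coker (hN : IsNilpotentBimodule R M N) (e : A ⟶ B) {π : B.a ⟶ G}
    (hB : Exact B.str.hom π.hom) (h : Surjective (e.f ≫ π).hom) :
    Surjective e.f.hom := by
  obtain ⟨D, q, hq, hex⟩ := exists_cokernel e
  have hs : Surjective D.str.hom := by
    intro d
    obtain ⟨b, rfl⟩ := hq d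
    obtain ⟨a, ha⟩ := h (π.hom b)
    have h0 : π.hom (b - e.f.hom a) = 0 := by
      rw [map_sub, sub_eq_zero]
      exact ha.symm
    obtain ⟨z, hz⟩ := (hB _).1 h0
    refine ⟨((𝔽).map q.f).hom z, ?_⟩
    rw [← hom_str, hz, map_sub, hex.apply_apply_eq_zero, sub_zero]
  have hD : Subsingleton D.a := by
    refine of_descending (p := fun k => Subsingleton ((powFunctor R M k).obj D.a)) (N + 1)
      (subsingleton_powFunctor hN D.a) fun k hk => ?_
    rw [powFunctor_succ'] at hk
    replace hk : Subsingleton ((powFunctor R M k).obj ((𝔽).obj D.a)) := hk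
    exact (powFunctor_surjective R M hs k).subsingleton
  intro b
  exact (hex b).1 (Subsingleton.elim _ _)

/-- The four lemma for M^k applied to both sequences: injectivity of M^(k+1) ⊗ f and M^k ⊗ γ gives
that of M^k ⊗ f. -/
lemma injective_of_injective_coker (hN : IsNilpotentBimodule R M N) (f : A ⟶ B) {π : A.a ⟶ G}
    {π' : B.a ⟶ G'} (hA : IsSES A.str π) (hB : IsSES B.str π') (hG : PowPreserves M G)
    (hG' : PowPreserves M G') (hG'' : PowPreserves M G'') {γ : G ⟶ G'} {δ : G' ⟶ G''}
    (hγ : IsSES γ δ) (hf : f.f ≫ π' = π ≫ γ) : Injective f.f.hom := by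
  refine of_descending (p := fun k => Injective ((powFunctor R M k).map f.f).hom) (N + 1)
    ?_ fun k hk => ?_
  · have := subsingleton_powFunctor hN A.a
    exact fun x y _ => Subsingleton.elim _ _
  · rw [powFunctor_succ'] at hk
    have hA' := hG.isSES hA k
    have hB' := hG'.isSES hB k
    refine (injective_iff_map_eq_zero ((powFunctor R M k).map f.f).hom).2 fun x hx => ?_
    have hsq : (powFunctor R M k).map f.f ≫ (powFunctor R M k).map π' =
        (powFunctor R M k).map π ≫ (powFunctor R M k).map γ := by
      rw [← Functor.map_comp, hf, Functor.map_comp]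
    have hsq' : (powFunctor R M k).map A.str ≫ (powFunctor R M k).map f.f =
        (powFunctor R M k).map ((𝔽).map f.f) ≫ (powFunctor R M k).map B.str := by
      rw [← Functor.map_comp, ← f.h, Functor.map_comp]
    have h1 := hom_hom_of_square hsq x
    rw [hx, map_zero] at h1
    have h2 := (hG''.isSES hγ k).inj (h1.symm.trans (map_zero _).symm)
    obtain ⟨y, rfl⟩ := (hA'.exact x).1 h2
    have h3 := hom_hom_of_square hsq' y
    rw [hx] at h3
    have h4 := hB'.inj (h3.symm.trans (map_zero _).symm)
    have h5 : y = 0 := hk (h4.trans (map_zero _).symm)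
    rw [h5, map_zero]

/-- The map g' is prescribed on the image of the structure map of B and on f(A). The quotient of B
by their sum is G'', so the only obstruction lies in Ext¹(G'', M ⊗ Y). -/
lemma exists_extension_tensor (f : A ⟶ B) {π : A.a ⟶ G} {π' : B.a ⟶ G'} (hA : IsSES A.str π)
    (hB : IsSES B.str π') {γ : G ⟶ G'} {δ : G' ⟶ G''} (hγ : IsSES γ δ) (hf : f.f ≫ π' = π ≫ γ)
    {Y : ModuleCat.{u} R} (hE : Subsingleton (Abelian.Ext G'' ((𝔽).obj Y) 1))
    (c : A.a ⟶ (𝔽).obj Y) (g : B.a ⟶ Y) (hc : A.str ≫ c = (𝔽).map (f.f ≫ g)) :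
    ∃ g' : B.a ⟶ (𝔽).obj Y, f.f ≫ g' = c ∧ B.str ≫ g' = (𝔽).map g := by
  let S : ModuleCat.{u} R := ModuleCat.of R (((𝔽).obj B.a) × A.a)
  let s : S ⟶ B.a := ModuleCat.ofHom (LinearMap.coprod B.str.hom f.f.hom)
  let φ' : S ⟶ (𝔽).obj Y :=
    ModuleCat.ofHom (LinearMap.coprod ((𝔽).map g).hom c.hom)
  have hcomp : ∀ b, c.hom (A.str.hom b) = ((𝔽).map g).hom (((𝔽).map f.f).hom b) := fun b => by
    rw [hom_hom_of_comp_eq hc, (𝔽).map_comp]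
    rfl
  have hex : Exact s.hom (π' ≫ δ).hom := by
    intro b
    constructor
    · intro hb
      obtain ⟨d, hd⟩ := (hγ.exact (π'.hom b)).1 hb
      obtain ⟨a, rfl⟩ := hA.surj d
      have hz : π'.hom (b - f.f.hom a) = 0 := by
        rw [map_sub, hom_hom_of_square hf, hd, sub_self]
      obtain ⟨z, hz⟩ := (hB.exact _).1 hz
      refine ⟨(z, a), ?_⟩
      change B.str.hom z + f.f.hom a = b
      rw [hz, sub_add_cancel]
    · rintro ⟨⟨z, a⟩, rfl⟩
      change δ.hom (π'.hom (B.str.hom z + f.f.hom a)) = 0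
      rw [map_add, hB.exact.apply_apply_eq_zero, zero_add, hom_hom_of_square hf,
        hγ.exact.apply_apply_eq_zero]
  -- The two prescriptions agree on the overlap: injectivity of γ puts a in the image of the
  -- structure map of A, where `hc` compares them.
  have hker : ∀ x, s.hom x = 0 → φ'.hom x = 0 := by
    rintro ⟨z, a⟩ hza
    replace hza : B.str.hom z + f.f.hom a = 0 := hza
    change ((𝔽).map g).hom z + c.hom a = (0 : (𝔽).obj Y)
    have h1 := congrArg π'.hom hza
    rw [map_add, hB.exact.apply_apply_eq_zero, zero_add, map_zero, hom_hom_of_square hf] at h1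
    obtain ⟨b, rfl⟩ := (hA.exact a).1 (hγ.inj (h1.trans (map_zero _).symm))
    rw [hom_str, ← map_add] at hza
    have h2 := hB.inj (hza.trans (map_zero _).symm)
    refine (congrArg (((𝔽).map g).hom z + ·) (hcomp b)).trans ?_
    rw [← map_add, h2, map_zero]
  obtain ⟨g', hg'⟩ := exists_extension_of_ext hE s (π' ≫ δ) hex (hγ.surj.comp hB.surj) φ' hker
  refine ⟨g', modHom_ext fun a => ?_, modHom_ext fun z => ?_⟩
  · have := hom_hom_of_comp_eq hg' ((0, a) : ((𝔽).obj B.a) × A.a)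
    change g'.hom (B.str.hom 0 + f.f.hom a) = ((𝔽).map g).hom 0 + c.hom a at this
    rw [map_zero, zero_add, map_zero] at this
    exact this.trans (zero_add _)
  · have := hom_hom_of_comp_eq hg' ((z, 0) : ((𝔽).obj B.a) × A.a)
    change g'.hom (B.str.hom z + f.f.hom 0) = ((𝔽).map g).hom z + c.hom 0 at this
    rw [map_zero, add_zero, map_zero] at this
    exact this.trans (add_zero _)

/-- Extension of morphisms to `Ind(X)` along a morphism of `T_R(M)`-modules. -/
lemma exists_extension_to_ind (hN : IsNilpotentBimodule R M N) (f : A ⟶ B) {π : A.a ⟶ G}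
    {π' : B.a ⟶ G'} (hA : IsSES A.str π) (hB : IsSES B.str π') {γ : G ⟶ G'} {δ : G' ⟶ G''}
    (hγ : IsSES γ δ) (hf : f.f ≫ π' = π ≫ γ) {X : ModuleCat.{u} R}
    (hE : ∀ k, Subsingleton (Abelian.Ext G'' (tensorPow R M X k) 1)) (h : A ⟶ ind R M N X) :
    ∃ h' : B ⟶ ind R M N X, f ≫ h' = h := by
  obtain ⟨φ, hφ0, hφ, hφh⟩ := exists_components hN h
  have h0 : ∃ g : B.a ⟶ tensorPow R M X 0, f.f ≫ g = φ 0 ∧ B.str ≫ g = 0 := by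
    obtain ⟨η, hη⟩ := exists_desc π hA.surj (φ 0) fun x hx => by
      obtain ⟨y, rfl⟩ := (hA.exact x).1 hx
      exact hom_hom_of_comp_eq_zero hφ0 y
    obtain ⟨θ, hθ⟩ := exists_extension_of_ext (hE 0) γ δ hγ.exact hγ.surj η fun x hx => by
      rw [hγ.inj (hx.trans (map_zero _).symm), map_zero]
    refine ⟨π' ≫ θ, ?_, ?_⟩
    · rw [← Category.assoc, hf, Category.assoc, ← hη]
      exact congrArg (π ≫ ·) hθ
    · rw [← Category.assoc, hB.zero, Limits.zero_comp]
  have hs : ∀ k (g : B.a ⟶ tensorPow R M X k), f.f ≫ g = φ k →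
      ∃ g' : B.a ⟶ tensorPow R M X (k + 1), f.f ≫ g' = φ (k + 1) ∧ B.str ≫ g' = (𝔽).map g :=
    fun k g hg => exists_extension_tensor f hA hB hγ hf (hE (k + 1)) (φ (k + 1)) g
      ((hφ k).trans (congrArg (𝔽).map hg.symm))
  obtain ⟨g₀, hg₀, hg₀'⟩ := h0
  obtain ⟨g, hg0, hgs⟩ := exists_dependent_seq
    (S := fun k => { g : B.a ⟶ tensorPow R M X k // f.f ≫ g = φ k }) ⟨g₀, hg₀⟩
    (fun k g g' => B.str ≫ g'.1 = (𝔽).map g.1) fun k g => by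
      obtain ⟨g', h1, h2⟩ := hs k g.1 g.2
      exact ⟨⟨g', h1⟩, h2⟩
  refine ⟨indLift (fun k => (g k).1) (by rw [hg0]; exact hg₀') hgs, ?_⟩
  refine Endofunctor.Algebra.Hom.ext (ind_hom_ext fun i => ?_)
  exact (g i).2.trans (hφh i).symm

/-- A short exact sequence `0 → A → P → B → 0` of `T_R(M)`-modules with `P` projective which stays
exact under `Hom(-, W)` for `W ∈ 𝒲`. -/
def IsSyzygy (𝒲 : ObjectProperty (TMod R M)) (A B : TMod R M) : Prop :=
  ∃ (P : TMod R M) (f : A ⟶ P) (g : P ⟶ B), Projective P ∧ IsSES f.f g.f ∧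
    ∀ W, 𝒲 W → ∀ h : A ⟶ W, ∃ h' : P ⟶ W, f ≫ h' = h

variable {𝒲 : ObjectProperty (TMod R M)}

/-- Iterates a choice of successor on nonnegative indices and of predecessor on negative ones,
carrying K in a subtype. -/
lemma exists_int_seq {α : Type*} {K : α → Prop} {r : α → α → Prop}
    (hr : ∀ a, K a → ∃ b, K b ∧ r a b) (hl : ∀ b, K b → ∃ a, K a ∧ r a b) {a : α} (ha : K a) :
    ∃ s : ℤ → α, s 0 = a ∧ ∀ n, r (s n) (s (n + 1)) := by
  choose R hRK hR using hr
  choose L hLK hL using hl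
  let nextR : { a // K a } → { a // K a } := fun a => ⟨R a.1 a.2, hRK _ _⟩
  let nextL : { a // K a } → { a // K a } := fun a => ⟨L a.1 a.2, hLK _ _⟩
  let s : ℤ → { a // K a }
    | .ofNat k => nextR^[k] ⟨a, ha⟩
    | .negSucc k => nextL^[k + 1] ⟨a, ha⟩
  refine ⟨fun n => (s n).1, rfl, fun n => ?_⟩
  obtain k | k := n
  · change r _ (nextR^[k + 1] ⟨a, ha⟩).1
    rw [Function.iterate_succ_apply']
    exact hR _ _
  · obtain _ | k := k
    · exact hL _ _
    · have : Int.negSucc (k + 1) + 1 = Int.negSucc k := by lia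
      rw [this]
      change r (nextL^[k + 1 + 1] ⟨a, ha⟩).1 _
      rw [Function.iterate_succ_apply']
      exact hL _ _

/-- A module all of whose iterated syzygies and cosyzygies exist is Gorenstein projective. -/
lemma gorensteinProj_of_isSyzygy {B : ℤ → TMod R M} (h : ∀ n, IsSyzygy 𝒲 (B n) (B (n + 1))) :
    GPT M 𝒲 (B 0) := by
  choose P f g hproj hses hext using h
  have hgf : ∀ n, f n ≫ g n = 0 := fun n => Endofunctor.Algebra.Hom.ext (hses n).zero
  let Q : CochainComplex (TMod R M) ℤ := CochainComplex.of P (fun n => g n ≫ f (n + 1))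
    fun n => by rw [Category.assoc, ← Category.assoc (f (n + 1)), hgf, Limits.zero_comp,
      Limits.comp_zero]
  have hd : ∀ n, Q.d n (n + 1) = g n ≫ f (n + 1) := fun n => by
    change CochainComplex.of.d P (fun n => g n ≫ f (n + 1)) n (n + 1) = _
    exact CochainComplex.of_d _ _ n
  refine ⟨Q, ⟨hproj, ?_, fun W hW => ?_⟩, g (-1), f 0, (hses (-1)).surj, (hses 0).inj,
    (hd (-1)).symm⟩
  · rw [isExactComplex_iff]
    rintro i _ _ rfl rfl
    change Exact (Q.d i (i + 1)).f.hom (Q.d (i + 1) (i + 1 + 1)).f.hom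
    rw [hd, hd]
    intro y
    have h1 : (g (i + 1) ≫ f (i + 1 + 1)).f.hom y = 0 ↔ (g (i + 1)).f.hom y = 0 :=
      map_eq_zero_iff (f (i + 1 + 1)).f.hom (hses _).inj
    rw [h1, (hses (i + 1)).exact y]
    constructor
    · rintro ⟨x, rfl⟩
      obtain ⟨w, rfl⟩ := (hses i).surj x
      exact ⟨w, rfl⟩
    · rintro ⟨w, rfl⟩
      exact ⟨_, rfl⟩
  · rw [isHomExact_iff]
    rintro i _ _ rfl rfl
    change ∀ φ : P (i + 1) ⟶ W, Q.d i (i + 1) ≫ φ = 0 → ∃ ψ : P (i + 1 + 1) ⟶ W,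
      Q.d (i + 1) (i + 1 + 1) ≫ ψ = φ
    intro φ hφ
    rw [hd, Category.assoc] at hφ
    have : Epi (g i) := tmod_epi_of_surjective _ (hses i).surj
    have hφ' : f (i + 1) ≫ φ = 0 := by
      rw [← cancel_epi (g i), hφ, Limits.comp_zero]
    obtain ⟨φ', rfl⟩ := tmod_exists_desc (g (i + 1)) (hses _).surj φ fun x hx => by
      obtain ⟨y, rfl⟩ := ((hses (i + 1)).exact x).1 hx
      rw [tmod_comp_apply hφ']
      rfl
    obtain ⟨ψ, rfl⟩ := hext (i + 1 + 1) W hW φ'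
    exact ⟨ψ, by rw [hd, Category.assoc]⟩

/-- `A` is an extension of a Gorenstein projective module `G` by `M ⊗ A`. -/
def HasGPCoker (𝒳 : ObjectProperty (ModuleCat.{u} R)) (A : TMod R M) : Prop :=
  ∃ (G : ModuleCat.{u} R) (π : A.a ⟶ G), GP 𝒳 G ∧ IsSES A.str π

/-- An embedding G → P of the cokernel lifts to an embedding A → Ind(P), whose cokernel B has coker
equal to G' = P/G. -/
lemma exists_cosyzygy (hN : IsNilpotentBimodule R M N)
    (h𝒳 : ∀ P : ModuleCat.{u} R, Projective P → 𝒳 P) (hadm : IsAdmissible M 𝒳)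
    {A : TMod R M} (hA : HasGPCoker 𝒳 A) :
    ∃ B, HasGPCoker 𝒳 B ∧ IsSyzygy (indClass R M N 𝒳) A B := by
  obtain ⟨G, π, hG, hπ⟩ := hA
  obtain ⟨P, G', γ, δ, hP, hG', hγ⟩ := hG.exists_coresolution
  have hGp := hadm.powPreserves h𝒳 hG
  have hG'p := hadm.powPreserves h𝒳 hG'
  -- Component k + 1 extends M ⊗ φ k along the injection u; the obstruction lies in Ext¹(G, M^(k+1)
  -- ⊗ P).
  obtain ⟨φ, hφ0, hφ⟩ := exists_dependent_seq (S := fun k => A.a ⟶ tensorPow R M P k) (π ≫ γ)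
    (fun k g g' => A.str ≫ g' = (𝔽).map g) fun k g =>
      exists_extension_of_ext (hadm G hG P (h𝒳 P hP) (k + 1)).1 A.str π hπ.exact hπ.surj
        ((𝔽).map g) fun x hx => by rw [hπ.inj (hx.trans (map_zero _).symm), map_zero]
  let f : A ⟶ ind R M N P := indLift φ (by
    rw [hφ0]
    exact modHom_ext fun x => by
      change γ.hom (π.hom (A.str.hom x)) = 0
      rw [hπ.exact.apply_apply_eq_zero, map_zero]) hφ
  have hf : f.f ≫ indTop P = π ≫ γ := hφ0
  have hI := isSES_ind hN P
  have hfi : Injective f.f.hom := injective_of_injective_coker hN f hπ hI hGp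
    (hGp.extension hG'p hγ) hG'p hγ hf
  obtain ⟨B, q, hq, hex⟩ := exists_cokernel f
  obtain ⟨ρ, hρ⟩ := exists_desc q.f hq (indTop P ≫ δ) fun x hx => by
    obtain ⟨a, rfl⟩ := (hex x).1 hx
    change δ.hom ((indTop P).hom (f.f.hom a)) = 0
    rw [hom_hom_of_square hf, hγ.exact.apply_apply_eq_zero]
  refine ⟨B, ⟨G', ρ, hG', ?_, fun y => ⟨fun hy => ?_, ?_⟩, fun c => ?_⟩,
    ind R M N P, f, q, projective_ind hN hP, ⟨hfi, hex, hq⟩, ?_⟩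
  · refine (injective_iff_map_eq_zero B.str.hom).2 fun y hy => ?_
    obtain ⟨z, rfl⟩ := tensor_surjective R M hq y
    rw [← hom_str] at hy
    obtain ⟨a, ha⟩ := (hex _).1 hy
    have h1 : γ.hom (π.hom a) = 0 := by
      rw [← hom_hom_of_square hf, ha]
      exact hI.exact.apply_apply_eq_zero z
    obtain ⟨b, rfl⟩ := (hπ.exact a).1 (hγ.inj (h1.trans (map_zero _).symm))
    rw [hom_str] at ha
    rw [← hI.inj ha]
    refine hom_hom_of_comp_eq_zero ?_ b
    have hfq : f.f ≫ q.f = 0 := modHom_ext hex.apply_apply_eq_zero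
    rw [← (𝔽).map_comp, hfq, (𝔽).map_zero]
  · obtain ⟨x, rfl⟩ := hq y
    rw [hom_hom_of_comp_eq hρ] at hy
    obtain ⟨c, hc⟩ := (hγ.exact ((indTop P).hom x)).1 hy
    obtain ⟨a, rfl⟩ := hπ.surj c
    have hz : (indTop P).hom (x - f.f.hom a) = 0 := by
      rw [map_sub, hom_hom_of_square hf, hc, sub_self]
    obtain ⟨z, hz⟩ := (hI.exact _).1 hz
    refine ⟨((𝔽).map q.f).hom z, ?_⟩
    rw [← hom_str, hz, map_sub, hex.apply_apply_eq_zero, sub_zero]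
  · rintro ⟨y, rfl⟩
    obtain ⟨z, rfl⟩ := tensor_surjective R M hq y
    rw [← hom_str, hom_hom_of_comp_eq hρ]
    change δ.hom ((indTop P).hom _) = 0
    rw [hI.exact.apply_apply_eq_zero, map_zero]
  · obtain ⟨p, rfl⟩ := hγ.surj c
    obtain ⟨x, rfl⟩ := hI.surj p
    exact ⟨q.f.hom x, hom_hom_of_comp_eq hρ x⟩
  · rintro _ ⟨X, hX, rfl⟩ h
    exact exists_extension_to_ind hN f hπ hI hγ hf (fun k => (hadm G' hG' X hX k).1) h

/-- A surjection P → G lifts to B and extends by adjunction to Ind(P) → B, surjective by Nakayama.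
The snake lemma then gives its kernel the cokernel G'. -/
lemma exists_syzygy (hN : IsNilpotentBimodule R M N)
    (h𝒳 : ∀ P : ModuleCat.{u} R, Projective P → 𝒳 P) (hadm : IsAdmissible M 𝒳)
    {B : TMod R M} (hB : HasGPCoker 𝒳 B) :
    ∃ A, HasGPCoker 𝒳 A ∧ IsSyzygy (indClass R M N 𝒳) A B := by
  obtain ⟨G, π, hG, hπ⟩ := hB
  obtain ⟨G', P, γ, δ, hP, hG', hγ⟩ := hG.exists_resolution
  have hI := isSES_ind hN P
  have : Epi π := (ModuleCat.epi_iff_surjective _).2 hπ.surj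
  obtain ⟨e, he⟩ := exists_ind_desc hN (A := B) (Projective.factorThru δ π)
  have hu : indUnit P ≫ e.f ≫ π = δ := by
    rw [← Category.assoc, he, Projective.factorThru_comp]
  -- Every x differs from the image of its top component by an element in the range of the structure
  -- map, which both sides kill.
  have heπ : e.f ≫ π = indTop P ≫ δ := modHom_ext fun x => by
    have h1 : (indTop P).hom (x - (indUnit P).hom ((indTop P).hom x)) = 0 := by
      rw [map_sub, hom_hom_of_comp_eq indUnit_indTop]
      exact sub_self _
    obtain ⟨z, hz⟩ := (hI.exact _).1 h1
    have h2 : (e.f ≫ π).hom ((ind R M N P).str.hom z) = 0 := by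
      change π.hom (e.f.hom _) = 0
      rw [hom_str, hπ.exact.apply_apply_eq_zero]
    rw [hz, map_sub, sub_eq_zero, hom_hom_of_comp_eq hu] at h2
    exact h2
  have hes : Surjective e.f.hom := by
    refine surjective_of_surjective_coker hN e hπ.exact ?_
    rw [heπ]
    exact hγ.surj.comp hI.surj
  obtain ⟨A, i, hi, hex⟩ := exists_kernel e
  have hie : i.f ≫ e.f = 0 := modHom_ext hex.apply_apply_eq_zero
  -- Vanishing Tor for M^k ⊗ G keeps M ⊗ A → M ⊗ Ind(P) injective, so the structure map of the
  -- kernel A is injective.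
  have hFi : Injective ((𝔽).map i.f).hom :=
    tensorPreserves_of_isSES hN hπ (hadm.powPreserves h𝒳 hG) i.f e.f ⟨hi, hex, hes⟩
  obtain ⟨ρ, hρ⟩ := exists_lift γ hγ.inj (i.f ≫ indTop P) fun a => by
    rw [← Set.mem_range, ← hγ.exact]
    change δ.hom ((indTop P).hom (i.f.hom a)) = 0
    rw [← hom_hom_of_square heπ, hex.apply_apply_eq_zero, map_zero]
  have hA : IsSES A.str ρ := by
    refine ⟨?_, fun a => ⟨fun ha => ?_, ?_⟩, fun c => ?_⟩
    · refine (injective_iff_map_eq_zero A.str.hom).2 fun y hy => ?_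
      refine hFi (hI.inj ?_)
      rw [← hom_str, hy, map_zero, map_zero, map_zero]
    · have h1 : (indTop P).hom (i.f.hom a) = 0 := by
        have := hom_hom_of_comp_eq hρ a
        rw [ha, map_zero] at this
        exact this.symm
      obtain ⟨z, hz⟩ := (hI.exact _).1 h1
      have h2 : B.str.hom (((𝔽).map e.f).hom z) = 0 := by
        rw [← hom_str, hz, hex.apply_apply_eq_zero]
      obtain ⟨w, rfl⟩ := (tensor_exact R M hex hes z).1 (hπ.inj (h2.trans (map_zero _).symm))
      exact ⟨w, hi ((hom_str i w).trans hz)⟩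
    · rintro ⟨w, rfl⟩
      refine hγ.inj ?_
      rw [hom_hom_of_comp_eq hρ, map_zero]
      change (indTop P).hom (i.f.hom (A.str.hom w)) = 0
      rw [hom_str, hI.exact.apply_apply_eq_zero]
    · obtain ⟨x, hx⟩ := hI.surj (γ.hom c)
      have h1 : π.hom (e.f.hom x) = 0 := by
        rw [hom_hom_of_square heπ, hx, hγ.exact.apply_apply_eq_zero]
      obtain ⟨b, hb⟩ := (hπ.exact _).1 h1
      obtain ⟨z, rfl⟩ := tensor_surjective R M hes b
      have h2 : e.f.hom (x - (ind R M N P).str.hom z) = 0 := by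
        rw [map_sub, hom_str, hb, sub_self]
      obtain ⟨a, ha⟩ := (hex _).1 h2
      refine ⟨a, hγ.inj ?_⟩
      rw [hom_hom_of_comp_eq hρ]
      change (indTop P).hom (i.f.hom a) = _
      rw [ha, map_sub, hx, hI.exact.apply_apply_eq_zero, sub_zero]
  refine ⟨A, ⟨G', ρ, hG', hA⟩, ind R M N P, i, e, projective_ind hN hP, ⟨hi, hex, hes⟩, ?_⟩
  rintro _ ⟨X, hX, rfl⟩ h
  exact exists_extension_to_ind hN i hA hI hγ hρ.symm (fun k => (hadm G hG X hX k).1) h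

lemma gorensteinProj_of_phi (hN : IsNilpotentBimodule R M N)
    (h𝒳 : ∀ P : ModuleCat.{u} R, Projective P → 𝒳 P) (hadm : IsAdmissible M 𝒳)
    {A : TMod R M} (hA : Phi M (GP 𝒳) A) : GPT M (indClass R M N 𝒳) A := by
  obtain ⟨B, rfl, hB⟩ := exists_int_seq (K := HasGPCoker 𝒳) (r := IsSyzygy (indClass R M N 𝒳))
    (fun _ => exists_cosyzygy hN h𝒳 hadm) (fun _ => exists_syzygy hN h𝒳 hadm)
    (a := A) ⟨_, cokerπ A, hA.2, hA.1, cokerπ_exact A, cokerπ_surjective A⟩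
  exact gorensteinProj_of_isSyzygy hB

end TMod

end

end TensorRing

theorem theorem2p7 (R : Type u) [Ring R] (M : Type u) [AddCommGroup M] [Module R M]
    [Module Rᵐᵒᵖ M] [SMulCommClass R Rᵐᵒᵖ M] (N : ℕ)
    (hN : TensorRing.IsNilpotentBimodule R M N)
    (𝒳 : ObjectProperty (ModuleCat.{u} R))
    (h𝒳 : ∀ P : ModuleCat.{u} R, Projective P → 𝒳 P)
    (hcomp : TensorRing.IsCompatible M N 𝒳)
    (hadm : TensorRing.IsAdmissible M 𝒳) :
    TensorRing.GPT M (TensorRing.indClass R M N 𝒳) = TensorRing.Phi M (TensorRing.GP 𝒳) := by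
  ext A
  exact ⟨TensorRing.phi_of_gorensteinProj hN hcomp, TensorRing.gorensteinProj_of_phi hN h𝒳 hadm⟩
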